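/- **Setting.** $G$ is a finite connected simple undirected graph with $n$ nodes, $m$ edges and maximum degree $\Delta$. Nodes are anonymous and without memory; at a node of degree $\delta$ the incident edges carry distinct port labels $0,\dots,\delta-1$, and the two labels of an edge are unrelated. There are $k\le n$ robots with distinct labels from $[1,k]$, placed arbitrarily at the nodes. They know none of $n,m,\Delta$; a robot communicates only with robots at the same node, and knows the port through which it entered. The system is asynchronous: in an arbitrary order chosen by an adversary, robots execute single atomic steps. $\mathrm{MUTEX}(v)$ selects one of the undocked robots contending for node $v$, arbitrarily, and from then on always returns this robot. **Algorithm Helping-Async.** Initially every robot $i$ has $port\_entered=parent\_ptr=-1$, $state=explore$, $seen=0$. An undocked robot $i$ repeats the following iteration. Unless this is its first iteration, it sets $port\_entered$ and $parent\_ptr$ to its entry port and $seen\gets0$. (a) If $state=explore$ and no robot is docked at the node, it calls $\mathrm{MUTEX}$. If it wins, it docks ($state\gets settled$), initializes arrays $visited[1..k]\gets 0$, $entry\_port[1..k]\gets -1$, and leaves this loop for the loop of docked robots. (b) If $state=explore$ and a robot $r$ is docked, or $r\ne i$ won the $\mathrm{MUTEX}$, then it waits for $(seen,parent\_ptr)=(visited[i],entry\_port[i])$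 from $r$; if $seen=0$ it sets $parent\_ptr\gets port\_entered$ and sends $port\_entered$ to $r$. If $seen=1$ and it did not just lose the $\mathrm{MUTEX}$, it sets $state\gets backtrack$ and moves through $port\_entered$; otherwise it sets $port\_entered\gets(port\_entered+1)\bmod\delta$, sets $state\gets backtrack$ if $port\_entered=parent\_ptr$, and moves through $port\_entered$. (c) If $state=backtrack$, it waits for $(seen,parent\_ptr)=(visited[i],entry\_port[i])$ from the docked robot, sets $port\_entered\gets(port\_entered+1)\bmod\delta$, sets $state\gets explore$ if $port\_entered\neq parent\_ptr$, and moves through $port\_entered$. A docked robot loops forever: for every other robot $j$ waiting at its node it sends $visited[j]$ and $entry\_port[j]$ to $j$, and if $visited[j]=0$ it sets $visited[j]\gets1$ and stores the $port\_entered$ received from $j$ in $entry\_port[j]$. **Theorem.** Algorithm Helping-Async achieves dispersion, without termination, in an asynchronous system, in $O(m)$ steps with $O(k\log\Delta)$ bits at each robot. Precisely: 1. In every execution, each robot, while undocked, executes at most $C\max(1,m)$ steps of its own (not counting the time in which it merely waits for a message) and makes at most $4m-2(n-1)$ moves along edges, where $C$ is an absolute constant. A docked robot stays docked at its node. If every robot,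 docked or not, takes infinitely many steps, then from some time on all robots are docked, at pairwise distinct nodes. 2. There is an absolute constant $C'$ such that, for all $k\ge1$ and $\Delta$, the label and the entire memory content of each robot, at any time of any execution with $k$ robots on any graph as above of maximum degree at most $\Delta$, can be encoded in $B$ bits for some $B\le C'\,k\max(1,\log_2\Delta)$, with a code that depends only on $k$ and $\Delta$. 3. Docked robots must stay active forever to help visiting robots: for every number $c$ there is an execution (on some graph as above, with some $k\le n$) in which a docked robot stops for good after at least $c$ further steps, all other robots take infinitely many steps, and yet some other robot stays undocked forever, waiting at the node of the stopped robot. -/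

import Mathlib

universe u

namespace HelpingAsync

/-- A port labelling of a graph: at every node `v`, the incident edges (i.e. the neighbours of `v`)
carry the labels `0, …, δ - 1`, where `δ` is the degree of `v`.  The two labels of an edge at its
two ends are unrelated. -/
structure PortLabeling {V : Type u} [Fintype V] [DecidableEq V] (G : SimpleGraph V)
    [DecidableRel G.Adj] where
  /-- the label, at `v`, of the edge from `v` to a neighbour -/
  port : (v : V) → G.neighborSet v ≃ Fin (G.degree v)

/-! ### The robots -/

/-- The variable `state` of a robot. -/
inductive RobotState
  | explore
  | backtrack
  | settled
deriving DecidableEq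

/-- The control point of a robot: where in the code of its current iteration it is.
* `start`: at the top of the main loop;
* `contend`: about to call `MUTEX(node)`, having seen that no robot is docked at the node;
* `await lost`: waiting for the message of the robot that docks at the node (`lost` says whether
  the robot has just lost `MUTEX(node)`);
* `act lost`: that message has been received; about to select a port and to move;
* `help`: in the endless loop of a docked robot. -/
inductive Phase
  | start
  | contend
  | await (lost : Bool)
  | act (lost : Bool)
  | help
deriving DecidableEq

/-- The complete memory of a robot (besides its label); ports range over `-1, 0, 1, …`, where `-1`
stands for no port.  The two arrays are only used from the moment on when the robot docks. -/
structure Memory (k : ℕ) where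
  phase : Phase
  state : RobotState
  portEntered : ℤ
  parentPtr : ℤ
  seen : Bool
  visited : Fin k → Bool
  entryPort : Fin k → ℤ

/-- The initial memory of every robot. -/
def Memory.init (k : ℕ) : Memory k where
  phase := .start
  state := .explore
  portEntered := -1
  parentPtr := -1
  seen := false
  visited := fun _ => false
  entryPort := fun _ => -1

/-- Where a robot is: at a node, with the port through which it came in (`none` in its first
iteration, before it has moved), or on an edge, on its way to a node that it is going to enter
through the given port. -/
inductive Place (V : Type u)
  | at (v : V) (entry : Option ℕ)
  | transit (v : V) (entry : ℕ)

/-- The node at which a robot is, if it is not on an edge. -/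
def Place.node? {V : Type u} : Place V → Option V
  | .at v _ => some v
  | .transit _ _ => none

/-- A configuration of the whole system of `k` robots, labelled by `Fin k`.  The component `lock`
is the state of the mutual exclusion primitive: `lock v` is the winner of `MUTEX(v)`, if there is
one already. -/
structure Config (V : Type u) (k : ℕ) where
  place : Fin k → Place V
  mem : Fin k → Memory k
  lock : V → Option (Fin k)

namespace Config

variable {V : Type u} {k : ℕ}

/-- Robot `i` is docked at node `v`. -/
abbrev DockedAt (c : Config V k) (i : Fin k) (v : V) : Prop :=
  (c.place i).node? = some v ∧ (c.mem i).state = .settled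

/-- Robot `i` contends for docking at node `v`. -/
abbrev ContendsAt (c : Config V k) (i : Fin k) (v : V) : Prop :=
  (c.place i).node? = some v ∧ (c.mem i).state ≠ .settled ∧ (c.mem i).phase = .contend

/-- Robot `i` is waiting (at a node) for the message of a docked robot. -/
abbrev Waits (c : Config V k) (i : Fin k) : Prop :=
  (c.mem i).phase = .await false ∨ (c.mem i).phase = .await true

/-- Robot `i` is waiting at node `v` for the message of the robot docked there. -/
abbrev WaitsAt (c : Config V k) (i : Fin k) (v : V) : Prop :=
  (c.place i).node? = some v ∧ (c.mem i).state ≠ .settled ∧ c.Waits i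

/-- Initially all robots are placed by `s`, and none has executed any code. -/
def init (s : Fin k → V) : Config V k where
  place := fun i => .at (s i) none
  mem := fun _ => Memory.init k
  lock := fun _ => none

end Config

section Algorithm

variable {V : Type u} [Fintype V] [DecidableEq V] {G : SimpleGraph V} [DecidableRel G.Adj] {k : ℕ}

/-- Where a robot at node `v` gets to when it moves through port `p`: onto the edge with this label
at `v`, towards the other end, which it will enter through the label of the edge there.
(If `v` has no port `p` then the robot stays where it is.) -/
def depart (L : PortLabeling G) (v : V) (entry : Option ℕ) (p : ℤ) : Place V :=
  if h : 0 ≤ p ∧ p.toNat < G.degree v then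
    let w := (L.port v).symm ⟨p.toNat, h.2⟩
    .transit w.1 (L.port w.1 ⟨v, w.2.symm⟩ : ℕ)
  else .at v entry

/-- Robot `i` is at the top of the main loop, at node `v`.  Except in its first iteration, it
records its entry port.  Then, if it backtracks or if a robot is docked at the node, it goes on to
communicate with the docked robot; otherwise it goes on to contend for the node. -/
def stepStart (i : Fin k) (v : V) (entry : Option ℕ) (c : Config V k) : Config V k :=
  let m : Memory k := c.mem i
  let m₁ : Memory k :=
    match entry with
    | none => m
    | some p => { m with portEntered := p, parentPtr := p, seen := false }
  let ph : Phase :=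
    if m.state = .backtrack ∨ ∃ j, c.DockedAt j v then .await false else .contend
  { c with mem := Function.update c.mem i { m₁ with phase := ph } }

/-- Robot `i` calls `MUTEX(v)`.  If there is no winner yet, then one of the contending robots is
selected (an arbitrary one: the robot `w` if that is contending for `v`, and otherwise robot `i`).
If robot `i` is the winner then it docks and initializes its two arrays.  Otherwise it goes on to
communicate with the winner. -/
def stepContend (i w : Fin k) (v : V) (c : Config V k) : Config V k :=
  let m : Memory k := c.mem i
  let r : Fin k :=
    match c.lock v with
    | some r => r
    | none => if c.ContendsAt w v then w else i
  let m' : Memory k :=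
    if r = i then
      { m with
        phase := .help
        state := .settled
        visited := fun _ => false
        entryPort := fun _ => -1 }
    else { m with phase := .await true }
  { c with mem := Function.update c.mem i m', lock := Function.update c.lock v (some r) }

/-- Robot `i`, at node `v`, has received the message of the docked robot and ends its iteration:
it selects the port through which to leave, updates `state`, and moves. -/
def stepAct (L : PortLabeling G) (i : Fin k) (v : V) (entry : Option ℕ) (lost : Bool)
    (c : Config V k) : Config V k :=
  let m : Memory k := c.mem i
  let next : ℤ := (m.portEntered + 1) % (G.degree v : ℤ)
  let m' : Memory k :=
    if m.state = .explore ∧ m.seen = true ∧ lost = false then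
      -- the node has been visited before: go back
      { m with phase := .start, state := .backtrack }
    else
      { m with
        phase := .start
        portEntered := next
        state := if next = m.parentPtr then .backtrack else .explore }
  { c with
    mem := Function.update c.mem i m'
    place := Function.update c.place i (depart L v entry m'.portEntered) }

/-- One pass of the endless loop of robot `j`, which is docked at node `v`: for every other robot
`i` that waits at the node, it sends `visited[i]` and `entry_port[i]` to `i`, and if `visited[i]`
is `0` then it sets `visited[i]` to `1` and receives `port_entered` from `i` as `entry_port[i]`.
On receipt, robot `i` sets `seen` and `parent_ptr` (where an exploring robot that is here for the
first time takes `port_entered` as its `parent_ptr`). -/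
def stepHelp (j : Fin k) (v : V) (c : Config V k) : Config V k :=
  let d : Memory k := c.mem j
  { c with
    mem := fun i =>
      let m : Memory k := c.mem i
      if i = j then
        { d with
          visited := fun x => d.visited x || decide (c.WaitsAt x v)
          entryPort := fun x =>
            if c.WaitsAt x v ∧ d.visited x = false then (c.mem x).portEntered
            else d.entryPort x }
      else if c.WaitsAt i v then
        { m with
          phase := if m.phase = .await true then .act true else .act false
          seen := d.visited i
          parentPtr :=
            if m.state = .explore ∧ d.visited i = false then m.portEntered else d.entryPort i }
      else m }

/-- One atomic step of robot `i` (the robot `w` is the choice of `MUTEX`, if it has one to make).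
A robot on an edge arrives at the end of the edge, a docked robot makes one pass of its endless
loop, and a robot that waits for the message of a docked robot just keeps waiting. -/
def step (L : PortLabeling G) (i w : Fin k) (c : Config V k) : Config V k :=
  match c.place i with
  | .transit v p => { c with place := Function.update c.place i (.at v (some p)) }
  | .at v entry =>
    if (c.mem i).state = .settled then stepHelp i v c
    else
      match (c.mem i).phase with
      | .start => stepStart i v entry c
      | .contend => stepContend i w v c
      | .await _ => c
      | .act lost => stepAct L i v entry lost c
      | .help => c

/-- The execution of the algorithm from the initial placement `s` of the robots, when the
asynchronous scheduler lets the robots `sched 0, sched 1, sched 2, …` take one step each, in this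
order, and `MUTEX` chooses according to `choice`. -/
def run (L : PortLabeling G) (s : Fin k → V) (sched choice : ℕ → Fin k) : ℕ → Config V k
  | 0 => Config.init s
  | t + 1 => step L (sched t) (choice t) (run L s sched choice t)

/-- The number of steps before time `t` in which robot `i` is active on its own behalf: it is not
docked yet, and it is not just waiting for a message. -/
def activeSteps (L : PortLabeling G) (s : Fin k → V) (sched choice : ℕ → Fin k)
    (i : Fin k) (t : ℕ) : ℕ :=
  ((Finset.range t).filter fun r =>
    sched r = i ∧ ((run L s sched choice r).mem i).state ≠ .settled ∧
      ¬ (run L s sched choice r).Waits i).card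

/-- The number of moves before time `t` of robot `i`: the steps of the robot that take it from a
node onto an edge. -/
def moves (L : PortLabeling G) (s : Fin k → V) (sched choice : ℕ → Fin k)
    (i : Fin k) (t : ℕ) : ℕ :=
  ((Finset.range t).filter fun r =>
    sched r = i ∧ ((run L s sched choice r).place i).node?.isSome = true ∧
      ((run L s sched choice (r + 1)).place i).node? = none).card

end Algorithm

/-- A robot takes infinitely many steps. -/
def ActiveForever {k : ℕ} (sched : ℕ → Fin k) (i : Fin k) : Prop :=
  ∀ t, ∃ t' ≥ t, sched t' = i

end HelpingAsync

/-!
As long as a robot `i` is undocked, it carries out a depth-first search, although its data are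
spread over the docked robots: all nodes at which the search has been are occupied, and their docked
robots store whether `i` has been there and through which port it first came. The search never ends:
if it had seen all nodes, then there would be `n` docked robots besides `i`. An explored port
accounts for at most two moves, and the ports to the parents are never explored, which gives at most
`2 (2 m - n + 1)` moves by the handshake lemma; between two moves there are boundedly many active
steps. Hence an active robot that never docks eventually waits forever at a node whose `MUTEX` has a
winner. But this winner docks with its next step, and answers with the one after it.

The memory of a robot consists of a bounded number of bits, of the `k` bits `visited`, and of
`k + 2` ports. If two robots start at the same end of a single edge, and one of them docks and stops
before the other one takes its first step, then the other one waits forever for an answer.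
-/

namespace HelpingAsync

/-! ### Ports -/

theorem exists_add_emod_eq {p q : ℤ} {d : ℕ} (hp : p ∈ Set.Ico 0 (d : ℤ))
    (hq : q ∈ Set.Ico 0 (d : ℤ)) (hqp : q ≠ p) : ∃ j : ℕ, 1 ≤ j ∧ j < d ∧ (p + j) % d = q := by
  obtain ⟨hp₀, hpd⟩ := hp
  obtain ⟨hq₀, hqd⟩ := hq
  rcases hqp.lt_or_gt with h | h
  · refine ⟨(q - p + d).toNat, by omega, by omega, ?_⟩
    rw [Int.toNat_of_nonneg (by omega), ← add_assoc, add_sub_cancel, Int.add_emod_right,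
      Int.emod_eq_of_lt hq₀ hqd]
  · refine ⟨(q - p).toNat, by omega, by omega, ?_⟩
    rw [Int.toNat_of_nonneg (by omega), add_sub_cancel, Int.emod_eq_of_lt hq₀ hqd]

theorem add_emod_eq_self_iff {p : ℤ} {d j : ℕ} (hp : p ∈ Set.Ico 0 (d : ℤ)) (hj : 1 ≤ j)
    (hjd : j ≤ d) : (p + j) % d = p ↔ j = d := by
  obtain ⟨hp₀, hpd⟩ := hp
  constructor
  · intro h
    by_contra hne
    rcases lt_or_ge (p + j) d with hlt | hge
    · rw [Int.emod_eq_of_lt (by omega) hlt] at h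
      omega
    · rw [← Int.sub_emod_right, Int.emod_eq_of_lt (by omega) (by omega)] at h
      omega
  · rintro rfl
    rw [Int.add_emod_right, Int.emod_eq_of_lt hp₀ hpd]

namespace PortLabeling

variable {V : Type u} [Fintype V] [DecidableEq V] {G : SimpleGraph V} [DecidableRel G.Adj]

/-- The label at `v` of the edge to `w`.  As in the memory of the robots, `-1` stands for no
port. -/
def portTo (L : PortLabeling G) (v w : V) : ℤ :=
  if h : G.Adj v w then ((L.port v ⟨w, h⟩ : ℕ) : ℤ) else -1

/-- The other end of the edge with label `p` at `v`.  It is only meaningful for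
`0 ≤ p < G.degree v`. -/
def neighbor (L : PortLabeling G) (v : V) (p : ℤ) : V :=
  if h : p.toNat < G.degree v then (L.port v).symm ⟨p.toNat, h⟩ else v

variable {L : PortLabeling G} {v w : V} {p : ℤ}

theorem portTo_self : L.portTo v v = -1 := by simp [portTo]

theorem portTo_mem_Ico (h : G.Adj v w) : L.portTo v w ∈ Set.Ico 0 (G.degree v : ℤ) := by
  simp [portTo, h]

theorem neighbor_portTo (h : G.Adj v w) : L.neighbor v (L.portTo v w) = w := by
  simp [portTo, neighbor, h]

theorem adj_neighbor (hp : p ∈ Set.Ico 0 (G.degree v : ℤ)) : G.Adj v (L.neighbor v p) := by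
  have hlt : p.toNat < G.degree v := (Int.toNat_lt hp.1).2 hp.2
  rw [neighbor, dif_pos hlt]
  exact ((L.port v).symm ⟨p.toNat, hlt⟩).2

theorem portTo_neighbor (hp : p ∈ Set.Ico 0 (G.degree v : ℤ)) :
    L.portTo v (L.neighbor v p) = p := by
  have hlt : p.toNat < G.degree v := (Int.toNat_lt hp.1).2 hp.2
  rw [portTo, dif_pos (adj_neighbor hp)]
  simp only [neighbor, hlt, dif_pos, Subtype.coe_eta, Equiv.apply_symm_apply]
  exact Int.toNat_of_nonneg hp.1

theorem eq_of_portTo_eq {w' : V} (h : G.Adj v w) (h' : G.Adj v w')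
    (he : L.portTo v w = L.portTo v w') : w = w' := by
  rw [← neighbor_portTo (L := L) h, he, neighbor_portTo h']

theorem depart_of_mem_Ico (entry : Option ℕ) (hp : p ∈ Set.Ico 0 (G.degree v : ℤ)) :
    depart L v entry p =
      .transit (L.neighbor v p) (L.portTo (L.neighbor v p) v).toNat := by
  have hlt : p.toNat < G.degree v := (Int.toNat_lt hp.1).2 hp.2
  have hadj : G.Adj v ((L.port v).symm ⟨p.toNat, hlt⟩) := ((L.port v).symm ⟨p.toNat, hlt⟩).2
  have hnb : L.neighbor v p = (L.port v).symm ⟨p.toNat, hlt⟩ := dif_pos hlt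
  rw [hnb]
  simp [depart, portTo, hp.1, hlt, hadj.symm]

end PortLabeling

/-! ### Depth-first search -/

open PortLabeling

/-- The history of a depth-first search: the nodes `seen` so far, those among them that have been
left for good towards their parents (`closed`), the parent of every node (the root is its own
parent), the number `off v` of ports of `v` explored so far, the depth in the search tree, the root,
and the end `top` of the current path in the search tree. -/
structure Trace (V : Type u) where
  seen : Finset V
  closed : Finset V
  parent : V → V
  off : V → ℕ
  depth : V → ℕ
  root : V
  top : V

namespace Trace

variable {V : Type u}

/-- The nodes seen form a tree in `G`. The depth makes the parent relation well-founded. -/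
structure IsTree (G : SimpleGraph V) (D : Trace V) : Prop where
  root_mem : D.root ∈ D.seen
  parent_root : D.parent D.root = D.root
  adj_parent : ∀ v ∈ D.seen, v ≠ D.root → G.Adj v (D.parent v)
  parent_mem : ∀ v ∈ D.seen, v ≠ D.root → D.parent v ∈ D.seen
  depth_parent_lt : ∀ v ∈ D.seen, v ≠ D.root → D.depth (D.parent v) < D.depth v

section Scan

variable [Fintype V]

/-- At no node have more ports been explored than there are, not counting the port to the parent,
and at a closed node all of them have been explored. -/
structure IsScan (G : SimpleGraph V) [DecidableRel G.Adj] (D : Trace V) : Prop where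
  off_lt : ∀ v ∈ D.seen, v ≠ D.root → D.off v < G.degree v
  off_root : D.off D.root ≤ G.degree D.root
  off_eq_zero : ∀ v ∉ D.seen, D.off v = 0
  off_closed : ∀ v ∈ D.closed, D.off v + 1 = G.degree v

theorem IsScan.sum_off_add_card_le {G : SimpleGraph V} [DecidableRel G.Adj] {D : Trace V}
    (h : D.IsScan G) (hG : G.Connected) :
    ∑ v, D.off v + Fintype.card V ≤ 2 * G.edgeFinset.card + 1 := by
  classical
  have hoff : ∀ v, D.off v + 1 ≤ G.degree v + if v = D.root then 1 else 0 := by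
    intro v
    split_ifs with hr
    · exact hr ▸ Nat.succ_le_succ h.off_root
    · by_cases hv : v ∈ D.seen
      · exact h.off_lt v hv hr
      · have : Nontrivial V := ⟨v, D.root, hr⟩
        rw [h.off_eq_zero v hv]
        exact hG.preconnected.degree_pos_of_nontrivial v
  simpa [Finset.sum_add_distrib, G.sum_degrees_eq_twice_card_edges] using
    Finset.sum_le_sum fun v (_ : v ∈ Finset.univ) => hoff v

end Scan

section Operations

variable [DecidableEq V]

/-- The history at the start of a search. -/
def init (r : V) : Trace V where
  seen := {r}
  closed := ∅
  parent := fun _ => r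
  off := fun _ => 0
  depth := fun _ => 0
  root := r
  top := r

/-- The search leaves the end of the current path towards its parent. -/
def close (D : Trace V) : Trace V :=
  { D with closed := insert D.top D.closed, top := D.parent D.top }

/-- The search explores another port at the end of the current path, but does not extend the path
by the node found there. -/
def skip (D : Trace V) : Trace V :=
  { D with off := Function.update D.off D.top (D.off D.top + 1) }

/-- The search explores another port at the end of the current path, and extends the path by the
node `w` found there. -/
def extend (D : Trace V) (w : V) : Trace V :=
  { D.skip with
    seen := insert w D.seen
    parent := Function.update D.parent w D.top
    depth := Function.update D.depth w (D.depth D.top + 1)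
    top := w }

variable {G : SimpleGraph V} {D : Trace V} {v w : V}

theorem skip_off_top : D.skip.off D.top = D.off D.top + 1 := Function.update_self ..

theorem skip_off_of_ne (h : v ≠ D.top) : D.skip.off v = D.off v := Function.update_of_ne h ..

theorem extend_parent_self : (D.extend w).parent w = D.top := Function.update_self ..

theorem extend_parent_of_ne (h : v ≠ w) : (D.extend w).parent v = D.parent v :=
  Function.update_of_ne h ..

theorem sum_skip_off [Fintype V] : ∑ v, D.skip.off v = ∑ v, D.off v + 1 := by
  have hskip : ∑ v, D.skip.off v = D.off D.top + 1 + ∑ v ∈ Finset.univ \ {D.top}, D.off v :=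
    Finset.sum_update_of_mem (Finset.mem_univ D.top) D.off _
  rw [hskip, Finset.sum_eq_add_sum_sdiff_singleton_of_mem (Finset.mem_univ D.top) D.off]
  omega

theorem IsTree.close (h : D.IsTree G) : D.close.IsTree G := { h with }

theorem IsTree.skip (h : D.IsTree G) : D.skip.IsTree G := { h with }

theorem IsTree.extend (h : D.IsTree G) (htop : D.top ∈ D.seen) (hadj : G.Adj w D.top)
    (hw : w ∉ D.seen) : (D.extend w).IsTree G := by
  have hne : ∀ v ∈ D.seen, v ≠ w := fun v hv hvw => hw (hvw ▸ hv)
  have hdepth : ∀ v ∈ D.seen, (D.extend w).depth v = D.depth v :=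
    fun v hv => Function.update_of_ne (hne v hv) ..
  have hdepth_self : (D.extend w).depth w = D.depth D.top + 1 := Function.update_self ..
  constructor
  case root_mem => exact Finset.mem_insert_of_mem h.root_mem
  case parent_root => exact (extend_parent_of_ne (hne _ h.root_mem)).trans h.parent_root
  all_goals
    intro v hv hr
    rcases Finset.mem_insert.1 hv with rfl | hv
  case adj_parent.inl => rwa [extend_parent_self]
  case adj_parent.inr => rw [extend_parent_of_ne (hne v hv)]; exact h.adj_parent v hv hr
  case parent_mem.inl => rw [extend_parent_self]; exact Finset.mem_insert_of_mem htop
  case parent_mem.inr =>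
    rw [extend_parent_of_ne (hne v hv)]
    exact Finset.mem_insert_of_mem (h.parent_mem v hv hr)
  case depth_parent_lt.inl => rw [extend_parent_self, hdepth _ htop, hdepth_self]; omega
  case depth_parent_lt.inr =>
    rw [extend_parent_of_ne (hne v hv), hdepth v hv, hdepth _ (h.parent_mem v hv hr)]
    exact h.depth_parent_lt v hv hr

end Operations

variable [Fintype V] [DecidableEq V] {G : SimpleGraph V} [DecidableRel G.Adj]

/-- The port of `v` explored as the `j`-th one: the ports are explored in cyclic order, beginning
after the one to the parent (at the root, where that is `-1`, with port `0`). -/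
def nthPort (L : PortLabeling G) (D : Trace V) (v : V) (j : ℕ) : ℤ :=
  (L.portTo v (D.parent v) + j) % (G.degree v : ℤ)

/-- The port that comes next at the end of the current path. -/
def next (L : PortLabeling G) (D : Trace V) : ℤ :=
  D.nthPort L D.top (D.off D.top + 1)

/-- The node behind the port that comes next at the end of the current path. -/
def nextNode (L : PortLabeling G) (D : Trace V) : V :=
  L.neighbor D.top (D.next L)

/-- The nodes that are seen but not closed form a path from the root to `D.top`, each of whose edges
is behind the port that was explored last at its upper end. -/
structure IsPath (L : PortLabeling G) (D : Trace V) : Prop where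
  top_mem : D.top ∈ D.seen
  top_open : D.top ∉ D.closed
  root_open : D.root ∉ D.closed
  closed_subset : D.closed ⊆ D.seen
  parent_open : ∀ v ∈ D.seen, v ≠ D.root → v ∉ D.closed → D.parent v ∉ D.closed
  parent_ne_top : ∀ v ∈ D.seen, v ≠ D.root → v ∉ D.closed → D.parent v ≠ D.top
  portTo_parent : ∀ v ∈ D.seen, v ≠ D.root → v ∉ D.closed →
    L.portTo (D.parent v) v = D.nthPort L (D.parent v) (D.off (D.parent v))

/-- `D` is the history of a depth-first search in `G` that has made `m` moves and is back on its
path. An explored edge accounts for two moves, except that no move back has been made yet from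
those nodes of the path that are not the root. -/
structure IsDfs (L : PortLabeling G) (m : ℕ) (D : Trace V) : Prop
    extends D.IsTree G, D.IsPath L, D.IsScan G where
  explored : ∀ v ∈ D.seen, ∀ j, 1 ≤ j → j ≤ D.off v → L.neighbor v (D.nthPort L v j) ∈ D.seen
  count : m + D.seen.card = 2 * ∑ v, D.off v + D.closed.card + 1

variable {L : PortLabeling G} {D : Trace V} {m : ℕ} {v w : V}

theorem nthPort_mem_Ico (hd : 0 < G.degree v) (j : ℕ) :
    D.nthPort L v j ∈ Set.Ico 0 (G.degree v : ℤ) :=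
  ⟨Int.emod_nonneg _ (by omega), Int.emod_lt_of_pos _ (by omega)⟩

theorem extend_nthPort_of_ne (h : v ≠ w) (j : ℕ) :
    (D.extend w).nthPort L v j = D.nthPort L v j := by
  simp only [nthPort, extend_parent_of_ne h]

theorem IsPath.close (h : D.IsPath L) (ht : D.IsTree G) (hr : D.top ≠ D.root) :
    D.close.IsPath L := by
  have hadj := ht.adj_parent _ h.top_mem hr
  have hopen : ∀ v, v ∉ D.close.closed → v ≠ D.top ∧ v ∉ D.closed := fun v hv => by
    simpa only [Trace.close, Finset.mem_insert, not_or] using hv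
  exact {
    top_mem := ht.parent_mem _ h.top_mem hr
    top_open := by
      simp [Trace.close, hadj.ne', h.parent_open _ h.top_mem hr h.top_open]
    root_open := by simp [Trace.close, hr.symm, h.root_open]
    closed_subset := Finset.insert_subset h.top_mem h.closed_subset
    parent_open := fun v hv hvr hc => by
      simpa [Trace.close] using
        ⟨h.parent_ne_top v hv hvr (hopen v hc).2, h.parent_open v hv hvr (hopen v hc).2⟩
    parent_ne_top := by
      -- Two children of the same node on the path are behind the same port.
      intro v hv hvr hc (he : D.parent v = D.parent D.top)
      have hport := h.portTo_parent v hv hvr (hopen v hc).2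
      rw [he, ← h.portTo_parent _ h.top_mem hr h.top_open] at hport
      exact (hopen v hc).1 <|
        eq_of_portTo_eq (he ▸ (ht.adj_parent v hv hvr).symm) hadj.symm hport
    portTo_parent := fun v hv hvr hc => h.portTo_parent v hv hvr (hopen v hc).2 }

theorem IsPath.skip (h : D.IsPath L) : D.skip.IsPath L :=
  { h with
    portTo_parent := fun v hv hr hc => by
      rw [show D.skip.parent v = D.parent v from rfl, skip_off_of_ne (h.parent_ne_top v hv hr hc)]
      exact h.portTo_parent v hv hr hc }

theorem IsPath.extend (h : D.IsPath L) (ht : D.IsTree G) (hport : L.portTo D.top w = D.next L)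
    (hw : w ∉ D.seen) : (D.extend w).IsPath L := by
  have hne : ∀ v ∈ D.seen, v ≠ w := fun v hv hvw => hw (hvw ▸ hv)
  constructor
  case top_mem => exact Finset.mem_insert_self ..
  case top_open => exact fun hc => hw (h.closed_subset hc)
  case root_open => exact h.root_open
  case closed_subset => exact h.closed_subset.trans (Finset.subset_insert ..)
  all_goals
    intro v hv hr hc
    rcases Finset.mem_insert.1 hv with rfl | hv
  case parent_open.inl => rw [extend_parent_self]; exact h.top_open
  case parent_open.inr => rw [extend_parent_of_ne (hne v hv)]; exact h.parent_open v hv hr hc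
  case parent_ne_top.inl => rw [extend_parent_self]; exact hne _ h.top_mem
  case parent_ne_top.inr =>
    rw [extend_parent_of_ne (hne v hv)]
    exact hne _ (ht.parent_mem v hv hr)
  case portTo_parent.inl =>
    rw [extend_parent_self, extend_nthPort_of_ne (hne _ h.top_mem)]
    change _ = D.nthPort L D.top (D.skip.off D.top)
    rw [skip_off_top, hport, next]
  case portTo_parent.inr =>
    rw [extend_parent_of_ne (hne v hv), extend_nthPort_of_ne (hne _ (ht.parent_mem v hv hr))]
    exact h.skip.portTo_parent v hv hr hc

theorem IsScan.close (h : D.IsScan G) (hoff : D.off D.top + 1 = G.degree D.top) :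
    D.close.IsScan G :=
  { h with
    off_closed := fun v hv => by
      rcases Finset.mem_insert.1 hv with rfl | hv
      · exact hoff
      · exact h.off_closed v hv }

theorem IsScan.skip (h : D.IsScan G) (hpath : D.IsPath L)
    (hoff : D.top ≠ D.root → D.off D.top + 1 < G.degree D.top)
    (hroot : D.top = D.root → D.off D.root < G.degree D.root) : D.skip.IsScan G where
  off_lt v hv hr := by
    by_cases hvt : v = D.top
    · subst hvt
      rw [skip_off_top]
      exact hoff hr
    · rw [skip_off_of_ne hvt]
      exact h.off_lt v hv hr
  off_root := by
    change D.skip.off D.root ≤ _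
    by_cases hvt : D.root = D.top
    · rw [hvt, skip_off_top, ← hvt]
      exact hroot hvt.symm
    · rw [skip_off_of_ne hvt]
      exact h.off_root
  off_eq_zero v hv := by
    rw [skip_off_of_ne fun (hvt : v = D.top) => hv (hvt ▸ hpath.top_mem)]
    exact h.off_eq_zero v hv
  off_closed v hv := by
    rw [skip_off_of_ne fun (hvt : v = D.top) => hpath.top_open (hvt ▸ hv)]
    exact h.off_closed v hv

theorem IsScan.extend (h : D.skip.IsScan G) (hw : w ∉ D.seen) (hd : 0 < G.degree w) :
    (D.extend w).IsScan G :=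
  { h with
    off_lt := fun v hv hr => by
      rcases Finset.mem_insert.1 hv with rfl | hv
      · exact (h.off_eq_zero v hw).trans_lt hd
      · exact h.off_lt v hv hr
    off_eq_zero := fun v hv => h.off_eq_zero v fun hv' => hv (Finset.mem_insert_of_mem hv') }

theorem isDfs_init (L : PortLabeling G) (r : V) : IsDfs L 0 (init r) := by
  constructor
  case toIsTree => constructor <;> simp +contextual [init]
  case toIsPath => constructor <;> simp +contextual [init]
  case toIsScan => constructor <;> simp +contextual [init]
  case explored =>
    intro v _ j hj hj'
    exact absurd (hj.trans hj') (by simp [init])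
  case count => simp [init]

namespace IsDfs

theorem closed_card_lt (h : IsDfs L m D) : D.closed.card < D.seen.card :=
  Finset.card_lt_card <| Finset.ssubset_iff_subset_ne.2
    ⟨h.closed_subset, fun he => h.root_open (he ▸ h.root_mem)⟩

theorem moves_le (h : IsDfs L m D) (hG : G.Connected) :
    m + 2 * (Fintype.card V - 1) ≤ 4 * G.edgeFinset.card := by
  have hpos : 0 < Fintype.card V := Fintype.card_pos_iff.2 ⟨D.root⟩
  have hclosed := h.closed_card_lt
  have hsum := h.toIsScan.sum_off_add_card_le hG
  have hcount := h.count
  omega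

theorem succ_moves_le (h : IsDfs L m D) (hG : G.Connected) (hskip : D.skip.IsScan G) :
    m + 1 + 2 * (Fintype.card V - 1) ≤ 4 * G.edgeFinset.card := by
  have hpos : 0 < Fintype.card V := Fintype.card_pos_iff.2 ⟨D.root⟩
  have hclosed := h.closed_card_lt
  have hsum := hskip.sum_off_add_card_le hG
  rw [sum_skip_off] at hsum
  have hcount := h.count
  omega

theorem mem_closed_of_top_eq_root (h : IsDfs L m D) (htop : D.top = D.root) (hv : v ∈ D.seen)
    (hr : v ≠ D.root) : v ∈ D.closed := by
  induction hn : D.depth v using Nat.strong_induction_on generalizing v with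
  | _ n ih =>
    by_contra hc
    have hpr : D.parent v ≠ D.root := htop ▸ h.parent_ne_top v hv hr hc
    exact h.parent_open v hv hr hc
      (ih _ (hn ▸ h.depth_parent_lt v hv hr) (h.parent_mem v hv hr) hpr rfl)

theorem mem_seen_of_adj_root (h : IsDfs L m D) (hoff : D.off D.root = G.degree D.root)
    (hw : G.Adj D.root w) : w ∈ D.seen := by
  have hport := portTo_mem_Ico (L := L) hw
  have hnth : D.nthPort L D.root (L.portTo D.root w + 1).toNat = L.portTo D.root w := by
    rw [nthPort, h.parent_root, portTo_self, Int.toNat_of_nonneg (by linarith [hport.1]),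
      neg_add_cancel_comm_assoc, Int.emod_eq_of_lt hport.1 hport.2]
  have hseen := h.explored D.root h.root_mem (L.portTo D.root w + 1).toNat
    (by have := hport.1; omega) (by have := hport.2; omega)
  rwa [hnth, neighbor_portTo hw] at hseen

theorem mem_seen_of_adj_closed (h : IsDfs L m D) (hv : v ∈ D.closed) (hw : G.Adj v w) :
    w ∈ D.seen := by
  have hvs := h.closed_subset hv
  have hr : v ≠ D.root := fun hr => h.root_open (hr ▸ hv)
  have hparent := h.adj_parent v hvs hr
  by_cases hwp : L.portTo v w = L.portTo v (D.parent v)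
  · rw [eq_of_portTo_eq hw hparent hwp]
    exact h.parent_mem v hvs hr
  · obtain ⟨j, hj, hjd, hjw⟩ :=
      exists_add_emod_eq (portTo_mem_Ico hparent) (portTo_mem_Ico hw) hwp
    have hoff := h.off_closed v hv
    have hseen := h.explored v hvs j hj (by omega)
    rwa [nthPort, hjw, neighbor_portTo hw] at hseen

theorem seen_eq_univ (h : IsDfs L m D) (hG : G.Connected) (htop : D.top = D.root)
    (hoff : D.off D.root = G.degree D.root) : D.seen = Finset.univ := by
  by_contra hne
  obtain ⟨v, hv⟩ : ∃ v, v ∉ D.seen := by simpa [Finset.eq_univ_iff_forall] using hne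
  obtain ⟨p⟩ := hG.preconnected D.root v
  obtain ⟨d, -, hfst, hsnd⟩ := p.exists_boundary_dart D.seen h.root_mem hv
  by_cases hr : d.fst = D.root
  · exact hsnd (h.mem_seen_of_adj_root hoff (hr ▸ d.adj))
  · exact hsnd (h.mem_seen_of_adj_closed (h.mem_closed_of_top_eq_root htop hfst hr) d.adj)

theorem top_ne_root (h : IsDfs L m D) (hn : D.next L = L.portTo D.top (D.parent D.top)) :
    D.top ≠ D.root := by
  intro hr
  rw [next, nthPort, hr, h.parent_root, portTo_self, Nat.cast_succ, neg_add_cancel_comm_assoc,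
    ← Int.natCast_mod] at hn
  omega

theorem off_top_add_one_eq_iff (h : IsDfs L m D) (hr : D.top ≠ D.root) :
    D.off D.top + 1 = G.degree D.top ↔ D.next L = L.portTo D.top (D.parent D.top) :=
  (add_emod_eq_self_iff (portTo_mem_Ico (h.adj_parent _ h.top_mem hr)) (by omega)
    (h.off_lt _ h.top_mem hr)).symm

theorem next_mem_Ico (h : IsDfs L m D) (hG : G.Connected) (hu : D.seen ≠ Finset.univ) :
    D.next L ∈ Set.Ico 0 (G.degree D.top : ℤ) := by
  obtain ⟨v, hv⟩ : ∃ v, v ∉ D.seen := by simpa [Finset.eq_univ_iff_forall] using hu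
  have : Nontrivial V := ⟨v, D.root, fun hr => hv (hr ▸ h.root_mem)⟩
  exact nthPort_mem_Ico (hG.preconnected.degree_pos_of_nontrivial _) _

theorem isScan_skip (h : IsDfs L m D) (hG : G.Connected) (hu : D.seen ≠ Finset.univ)
    (hn : D.next L ≠ L.portTo D.top (D.parent D.top)) : D.skip.IsScan G :=
  h.toIsScan.skip h.toIsPath
    (fun hr => lt_of_le_of_ne (h.off_lt _ h.top_mem hr) fun he =>
      hn ((h.off_top_add_one_eq_iff hr).1 he))
    (fun hr => lt_of_le_of_ne h.off_root fun he => hu (h.seen_eq_univ hG hr he))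

theorem nextNode_eq_parent (h : IsDfs L m D) (hn : D.next L = L.portTo D.top (D.parent D.top)) :
    D.nextNode L = D.parent D.top := by
  rw [nextNode, hn, neighbor_portTo (h.adj_parent _ h.top_mem (h.top_ne_root hn))]

theorem close (h : IsDfs L m D) (hn : D.next L = L.portTo D.top (D.parent D.top)) :
    IsDfs L (m + 1) D.close where
  toIsTree := h.toIsTree.close
  toIsPath := h.toIsPath.close h.toIsTree (h.top_ne_root hn)
  toIsScan := h.toIsScan.close ((h.off_top_add_one_eq_iff (h.top_ne_root hn)).2 hn)
  explored := h.explored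
  count := by
    change _ = 2 * ∑ v, D.off v + (insert D.top D.closed).card + 1
    rw [Finset.card_insert_of_notMem h.top_open]
    have hcount := h.count
    change m + 1 + D.seen.card = _
    omega

theorem explored_skip (h : IsDfs L m D) {j : ℕ} (hv : v ∈ D.seen) (hj : 1 ≤ j)
    (hjo : j ≤ D.skip.off v) :
    v = D.top ∧ D.nthPort L v j = D.next L ∨ L.neighbor v (D.nthPort L v j) ∈ D.seen := by
  by_cases hlt : j ≤ D.off v
  · exact .inr (h.explored v hv j hj hlt)
  · by_cases hvt : v = D.top
    · subst hvt
      rw [skip_off_top] at hjo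
      exact .inl ⟨rfl, by rw [next, show j = D.off D.top + 1 by omega]⟩
    · exact absurd (skip_off_of_ne hvt ▸ hjo) hlt

theorem skip (h : IsDfs L m D) (hskip : D.skip.IsScan G) (hnext : D.nextNode L ∈ D.seen) :
    IsDfs L (m + 2) D.skip where
  toIsTree := h.toIsTree.skip
  toIsPath := h.toIsPath.skip
  toIsScan := hskip
  explored v hv j hj hjo := by
    rcases h.explored_skip hv hj hjo with ⟨rfl, hjn⟩ | hseen
    · exact hjn ▸ hnext
    · exact hseen
  count := by
    rw [sum_skip_off]
    have hcount := h.count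
    change m + 2 + D.seen.card = _ + D.closed.card + 1
    omega

theorem extend (h : IsDfs L m D) (hG : G.Connected) (hskip : D.skip.IsScan G)
    (hnext : D.nextNode L ∉ D.seen) : IsDfs L (m + 1) (D.extend (D.nextNode L)) := by
  have hIco := h.next_mem_Ico hG fun hu => hnext (hu ▸ Finset.mem_univ _)
  have hadj : G.Adj D.top (D.nextNode L) := adj_neighbor hIco
  exact {
    toIsTree := h.toIsTree.extend h.top_mem hadj.symm hnext
    toIsPath := h.toIsPath.extend h.toIsTree (portTo_neighbor hIco) hnext
    toIsScan := hskip.extend hnext ((G.degree_pos_iff_exists_adj _).2 ⟨_, hadj.symm⟩)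
    explored := fun v hv j hj hjo => by
      rcases Finset.mem_insert.1 hv with rfl | hv
      · have hzero : D.skip.off (D.nextNode L) = 0 := hskip.off_eq_zero _ hnext
        exact absurd (hj.trans (hjo.trans hzero.le)) (by norm_num)
      · rw [extend_nthPort_of_ne fun (hvw : v = D.nextNode L) => hnext (hvw ▸ hv)]
        rcases h.explored_skip hv hj hjo with ⟨rfl, hjn⟩ | hseen
        · exact hjn ▸ Finset.mem_insert_self ..
        · exact Finset.mem_insert_of_mem hseen
    count := by
      change m + 1 + (insert (D.nextNode L) D.seen).card =
        2 * ∑ v, D.skip.off v + D.closed.card + 1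
      rw [sum_skip_off, Finset.card_insert_of_notMem hnext]
      have hcount := h.count
      omega }

end IsDfs

end Trace

/-! ### Steps of the robots -/

section Configurations

variable {V : Type u} {k : ℕ} {c : Config V k} {i j : Fin k} {v : V}

theorem Place.node?_eq_some_iff {P : Place V} : P.node? = some v ↔ ∃ e, P = .at v e := by
  cases P <;> simp [Place.node?]

theorem Place.node?_eq_none_iff {P : Place V} : P.node? = none ↔ ∃ v e, P = .transit v e := by
  cases P <;> simp [Place.node?]

/-- The invariant that ties the docked robots to the mutual exclusion primitive: the winner of
`MUTEX(v)` is docked at `v`, or it is still at `v` and about to learn that it has won. -/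
structure Config.Sound (c : Config V k) : Prop where
  settled_iff : ∀ i, (c.mem i).state = .settled ↔ (c.mem i).phase = .help
  phase_of_transit : ∀ i v p, c.place i = .transit v p → (c.mem i).phase = .start
  lock_of_dockedAt : ∀ i v, c.DockedAt i v → c.lock v = some i
  of_lock : ∀ i v, c.lock v = some i → (c.place i).node? = some v ∧
    ((c.mem i).phase = .help ∨ (c.mem i).phase = .contend)

theorem sound_init (s : Fin k → V) : (Config.init s).Sound := by
  constructor <;> simp [Config.init, Memory.init]

theorem Config.Sound.dockedAt_unique (h : c.Sound) (hi : c.DockedAt i v) (hj : c.DockedAt j v) :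
    i = j :=
  Option.some.inj ((h.lock_of_dockedAt i v hi).symm.trans (h.lock_of_dockedAt j v hj))

theorem Config.Sound.exists_dockedAt (h : c.Sound) (hi : (c.mem i).state = .settled) :
    ∃ v, c.DockedAt i v := by
  cases hn : (c.place i).node? with
  | some v => exact ⟨v, hn, hi⟩
  | none =>
    obtain ⟨v, p, hp⟩ := Place.node?_eq_none_iff.1 hn
    have hphase := h.phase_of_transit i v p hp
    rw [(h.settled_iff i).1 hi] at hphase
    cases hphase

variable [DecidableEq V]

/-- Robot `i` wins `MUTEX(v)` and docks. -/
def stepDock (i : Fin k) (v : V) (c : Config V k) : Config V k :=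
  { c with
    mem := Function.update c.mem i { c.mem i with
      phase := .help
      state := .settled
      visited := fun _ => false
      entryPort := fun _ => -1 }
    lock := Function.update c.lock v (some i) }

/-- Robot `i` loses `MUTEX(v)` to robot `r`. -/
def stepLose (i r : Fin k) (v : V) (c : Config V k) : Config V k :=
  { c with
    mem := Function.update c.mem i { c.mem i with phase := .await true }
    lock := Function.update c.lock v (some r) }

theorem stepHelp_state (i : Fin k) : ((stepHelp j v c).mem i).state = (c.mem i).state := by
  simp only [stepHelp]
  split_ifs with h
  · rw [h]
  all_goals rfl

theorem stepHelp_phase (hj : (c.mem j).state = .settled) (i : Fin k) :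
    ((stepHelp j v c).mem i).phase = if c.WaitsAt i v then
      (if (c.mem i).phase = .await true then .act true else .act false) else (c.mem i).phase := by
  simp only [stepHelp]
  by_cases h : i = j
  · subst h
    simp [hj]
  · split_ifs <;> rfl

theorem stepHelp_mem_of_waitsAt (hij : i ≠ j) (hi : c.WaitsAt i v) :
    (stepHelp j v c).mem i = { c.mem i with
      phase := .act (decide ((c.mem i).phase = .await true))
      seen := (c.mem j).visited i
      parentPtr := if (c.mem i).state = .explore ∧ (c.mem j).visited i = false
        then (c.mem i).portEntered else (c.mem j).entryPort i } := by
  simp only [stepHelp, if_neg hij, if_pos hi]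
  split_ifs <;> simp [*]

theorem stepHelp_mem_of_not_waitsAt (hij : i ≠ j) (hi : ¬ c.WaitsAt i v) :
    (stepHelp j v c).mem i = c.mem i := by
  simp only [stepHelp, if_neg hij, if_neg hi]

end Configurations

section Transitions

variable {V : Type u} [Fintype V] [DecidableEq V] {G : SimpleGraph V} [DecidableRel G.Adj] {k : ℕ}

/-- `c'` may result from `c` by a step of robot `i`.  In contrast to `step`, this does not mention
the choice made by `MUTEX`. -/
inductive Transition (L : PortLabeling G) (i : Fin k) (c : Config V k) : Config V k → Prop
  | arrive (v : V) (p : ℕ) (hp : c.place i = .transit v p) :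
      Transition L i c { c with place := Function.update c.place i (.at v (some p)) }
  | help (v : V) (e : Option ℕ) (hp : c.place i = .at v e) (hs : (c.mem i).state = .settled) :
      Transition L i c (stepHelp i v c)
  | start (v : V) (e : Option ℕ) (hp : c.place i = .at v e) (hs : (c.mem i).state ≠ .settled)
      (hph : (c.mem i).phase = .start) : Transition L i c (stepStart i v e c)
  | dock (v : V) (e : Option ℕ) (hp : c.place i = .at v e) (hs : (c.mem i).state ≠ .settled)
      (hph : (c.mem i).phase = .contend) (hl : c.lock v = none ∨ c.lock v = some i) :
      Transition L i c (stepDock i v c)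
  | lose (v : V) (e : Option ℕ) (hp : c.place i = .at v e) (hs : (c.mem i).state ≠ .settled)
      (hph : (c.mem i).phase = .contend) (r : Fin k) (hr : r ≠ i)
      (hl : c.lock v = some r ∨ c.lock v = none ∧ c.ContendsAt r v) :
      Transition L i c (stepLose i r v c)
  | act (v : V) (e : Option ℕ) (lost : Bool) (hp : c.place i = .at v e)
      (hs : (c.mem i).state ≠ .settled) (hph : (c.mem i).phase = .act lost) :
      Transition L i c (stepAct L i v e lost c)
  | idle (v : V) (e : Option ℕ) (hp : c.place i = .at v e) (hs : (c.mem i).state ≠ .settled)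
      (hph : c.Waits i ∨ (c.mem i).phase = .help) : Transition L i c c

theorem transition_stepContend (L : PortLabeling G) {i : Fin k} (w : Fin k) {v : V}
    {c : Config V k} {e : Option ℕ} (hp : c.place i = .at v e) (hs : (c.mem i).state ≠ .settled)
    (hph : (c.mem i).phase = .contend) : Transition L i c (stepContend i w v c) := by
  have hdock := Transition.dock (L := L) v e hp hs hph
  have hlose := Transition.lose (L := L) v e hp hs hph
  unfold stepContend
  cases hl : c.lock v with
  | some r =>
    by_cases hr : r = i
    · subst hr
      simpa [stepDock] using hdock (.inr hl)
    · simpa [hr, stepLose] using hlose r hr (.inl hl)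
  | none =>
    by_cases hw : c.ContendsAt w v ∧ w ≠ i
    · have hww : (if c.ContendsAt w v then w else i) = w := if_pos hw.1
      simpa [stepLose, hww, hw.2] using hlose w hw.2 (.inr ⟨hl, hw.1⟩)
    · have hwi : (if c.ContendsAt w v then w else i) = i := by
        split_ifs with hcw
        · exact not_not.1 (not_and.1 hw hcw)
        · rfl
      simpa [stepDock, hwi] using hdock (.inl hl)

theorem transition_step (L : PortLabeling G) (i w : Fin k) (c : Config V k) :
    Transition L i c (step L i w c) := by
  unfold step
  split
  case h_1 v p hp => exact .arrive v p hp
  case h_2 v e hp =>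
    split_ifs with hs
    · exact .help v e hp hs
    split
    case h_1 hph => exact .start v e hp hs hph
    case h_2 hph => exact transition_stepContend L w hp hs hph
    case h_3 lost hph => exact .idle v e hp hs (.inl (by cases lost <;> simp [Config.Waits, hph]))
    case h_4 lost hph => exact .act v e lost hp hs hph
    case h_5 hph => exact .idle v e hp hs (.inr hph)

namespace Transition

variable {L : PortLabeling G} {c c' : Config V k} {i j : Fin k} {v : V} {e : Option ℕ}

theorem eq_stepHelp (h : Transition L i c c') (hd : c.DockedAt i v) : c' = stepHelp i v c := by
  obtain ⟨e, hp⟩ := Place.node?_eq_some_iff.1 hd.1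
  cases h <;> simp_all

theorem eq_of_transit {p : ℕ} (h : Transition L i c c') (hp : c.place i = .transit v p) :
    c' = { c with place := Function.update c.place i (.at v (some p)) } := by
  cases h <;> simp_all

theorem eq_stepStart (h : Transition L i c c') (hp : c.place i = .at v e)
    (hs : (c.mem i).state ≠ .settled) (hph : (c.mem i).phase = .start) :
    c' = stepStart i v e c := by
  cases h <;> grind

theorem eq_stepAct {lost : Bool} (h : Transition L i c c') (hp : c.place i = .at v e)
    (hs : (c.mem i).state ≠ .settled) (hph : (c.mem i).phase = .act lost) :
    c' = stepAct L i v e lost c := by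
  cases h <;> grind

theorem eq_self_of_waits (h : Transition L i c c') (hc : c.Sound)
    (hs : (c.mem i).state ≠ .settled) (hw : c.Waits i) : c' = c := by
  cases h with
  | arrive v p hp => simp [Config.Waits, hc.phase_of_transit i v p hp] at hw
  | _ => grind

theorem eq_stepLose (h : Transition L i c c') (hp : c.place i = .at v e)
    (hph : (c.mem i).phase = .contend) (hs' : (c'.mem i).state ≠ .settled) :
    ∃ r ≠ i, c' = stepLose i r v c := by
  cases h with
  | dock => simp [stepDock] at hs'
  | help _ _ _ hs => exact absurd ((stepHelp_state i).trans hs) hs'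
  | _ => grind

theorem eq_stepDock (h : Transition L i c c') (hs : (c.mem i).state ≠ .settled)
    (hs' : (c'.mem i).state = .settled) :
    ∃ v, (c.place i).node? = some v ∧ (c.lock v = none ∨ c.lock v = some i) ∧
      c' = stepDock i v c := by
  cases h with
  | dock v e hp _ _ hl => exact ⟨v, by rw [hp]; rfl, hl, rfl⟩
  | help => contradiction
  | arrive | idle => exact absurd hs' hs
  | start v e => cases e <;> simp [stepStart, hs] at hs'
  | lose => simp [stepLose, hs] at hs'
  | act =>
    simp only [stepAct, Function.update_self] at hs'
    split_ifs at hs'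

theorem place_of_ne (h : Transition L j c c') (hij : i ≠ j) : c'.place i = c.place i := by
  cases h <;> simp [stepHelp, stepStart, stepAct, stepDock, stepLose, hij]

theorem mem_of_ne (h : Transition L j c c') (hij : i ≠ j)
    (hw : ∀ v, c.DockedAt j v → ¬ c.WaitsAt i v) : c'.mem i = c.mem i := by
  cases h with
  | help v e hp hs => exact stepHelp_mem_of_not_waitsAt hij (hw v ⟨by rw [hp]; rfl, hs⟩)
  | _ => simp [stepStart, stepAct, stepDock, stepLose, hij]

theorem state_of_ne (h : Transition L j c c') (hij : i ≠ j) :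
    (c'.mem i).state = (c.mem i).state := by
  cases h with
  | help => exact stepHelp_state i
  | _ => simp [stepStart, stepAct, stepDock, stepLose, hij]

theorem sound (h : Transition L j c c') (hc : c.Sound) : c'.Sound := by
  obtain ⟨settled_iff, phase_of_transit, lock_of_dockedAt, of_lock⟩ := hc
  cases h with
  | idle => constructor <;> assumption
  | arrive v p hp =>
    have hstart := phase_of_transit j v p hp
    constructor <;> simp only [Function.update_apply, Config.DockedAt] at * <;> grind [Place.node?]
  | help v e hp hs =>
    constructor <;>
      simp only [Config.DockedAt, stepHelp_state, stepHelp_phase hs] at * <;>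
      grind [stepHelp]
  | start v e =>
    constructor <;> simp only [stepStart, Function.update_apply, Config.DockedAt] at * <;> grind
  | dock v e =>
    constructor <;> simp only [stepDock, Function.update_apply, Config.DockedAt] at * <;>
      grind [Place.node?]
  | lose v e =>
    constructor <;>
      simp only [stepLose, Function.update_apply, Config.DockedAt, Config.ContendsAt] at * <;>
      grind [Place.node?]
  | act v e lost =>
    constructor <;> simp only [stepAct, Function.update_apply, Config.DockedAt] at * <;>
      grind [Place.node?]

theorem dockedAt (h : Transition L j c c') (hd : c.DockedAt i v) : c'.DockedAt i v := by
  rcases eq_or_ne i j with rfl | hij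
  · rw [h.eq_stepHelp hd, Config.DockedAt, stepHelp_state]
    exact hd
  · rw [Config.DockedAt, h.place_of_ne hij, h.state_of_ne hij]
    exact hd

theorem dockedAt_iff (h : Transition L j c c') (hc : c.Sound)
    (hj : (c'.mem j).state = .settled → (c.mem j).state = .settled) :
    c'.DockedAt i v ↔ c.DockedAt i v := by
  refine ⟨fun hd => ?_, h.dockedAt⟩
  rcases eq_or_ne i j with rfl | hij
  · obtain ⟨w, hw⟩ := hc.exists_dockedAt (hj hd.2)
    rw [h.eq_stepHelp hw] at hd
    exact ⟨hd.1, hw.2⟩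
  · rwa [Config.DockedAt, h.place_of_ne hij, h.state_of_ne hij] at hd

theorem lock (h : Transition L j c c') (hl : c.lock v = some i) : c'.lock v = some i := by
  cases h with
  | dock | lose => simp only [stepDock, stepLose, Function.update_apply]; grind
  | _ => exact hl

end Transition

theorem transition_run (L : PortLabeling G) (s : Fin k → V) (sched choice : ℕ → Fin k) (t : ℕ) :
    Transition L (sched t) (run L s sched choice t) (run L s sched choice (t + 1)) :=
  transition_step _ _ _ _

theorem sound_run (L : PortLabeling G) (s : Fin k → V) (sched choice : ℕ → Fin k) (t : ℕ) :
    (run L s sched choice t).Sound := by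
  induction t with
  | zero => exact sound_init s
  | succ t ih => exact (transition_run ..).sound ih

variable {L : PortLabeling G} {s : Fin k → V} {sched choice : ℕ → Fin k}

theorem dockedAt_run {i : Fin k} {v : V} {t t' : ℕ} (ht : t ≤ t')
    (h : (run L s sched choice t).DockedAt i v) : (run L s sched choice t').DockedAt i v := by
  induction t', ht using Nat.le_induction with
  | base => exact h
  | succ t' _ ih => exact (transition_run ..).dockedAt ih

theorem lock_run {i : Fin k} {v : V} {t t' : ℕ} (ht : t ≤ t')
    (h : (run L s sched choice t).lock v = some i) : (run L s sched choice t').lock v = some i := by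
  induction t', ht using Nat.le_induction with
  | base => exact h
  | succ t' _ ih => exact (transition_run ..).lock ih

end Transitions

/-! ### The search carried out by a robot -/

section Records

variable {V : Type u} [DecidableEq V] {k : ℕ}

/-- The docked robots hold the data of the search of robot `i`: a robot is docked at every node of
`S`, and the docked robots have stored for robot `i` that exactly the nodes of `S` have been
visited, with `par` as the ports to the parents. -/
structure Config.Records (c : Config V k) (i : Fin k) (S : Finset V) (par : V → ℤ) : Prop where
  docked : ∀ v ∈ S, ∃ j, c.DockedAt j v
  visited : ∀ j v, c.DockedAt j v → (c.mem j).visited i = decide (v ∈ S)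
  entryPort : ∀ j v, c.DockedAt j v → v ∈ S → (c.mem j).entryPort i = par v

namespace Config.Records

variable {c c' : Config V k} {i j : Fin k} {v : V} {S : Finset V} {par par' : V → ℤ}

theorem ne_univ [Fintype V] (h : c.Records i S par) (hi : (c.mem i).state ≠ .settled)
    (hk : k ≤ Fintype.card V) : S ≠ Finset.univ := by
  rintro rfl
  choose f hf using fun v => h.docked v (Finset.mem_univ v)
  have hinj : Function.Injective f := fun a b hab =>
    Option.some.inj ((hf a).1.symm.trans (hab ▸ (hf b).1))
  have hcard : Fintype.card V = Fintype.card (Fin k) :=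
    le_antisymm (Fintype.card_le_of_injective f hinj) (by simpa using hk)
  obtain ⟨v, hv⟩ := ((Fintype.bijective_iff_injective_and_card f).2 ⟨hinj, hcard⟩).2 i
  exact hi (hv ▸ (hf v).2)

theorem congr (h : c.Records i S par) (hd : ∀ l v, c'.DockedAt l v ↔ c.DockedAt l v)
    (hm : ∀ l v, c.DockedAt l v → (c'.mem l).visited i = (c.mem l).visited i ∧
      (c'.mem l).entryPort i = (c.mem l).entryPort i) : c'.Records i S par where
  docked v hv := (h.docked v hv).imp fun l hl => (hd l v).2 hl
  visited l v hl := (hm l v ((hd l v).1 hl)).1.trans (h.visited l v ((hd l v).1 hl))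
  entryPort l v hl hv := (hm l v ((hd l v).1 hl)).2.trans (h.entryPort l v ((hd l v).1 hl) hv)

theorem stepDock (h : c.Records i S par) (hc : c.Sound) (hp : (c.place j).node? = some v)
    (hj : (c.mem j).state ≠ .settled) (hl : c.lock v = none ∨ c.lock v = some j) :
    (stepDock j v c).Records i S par := by
  have hv : v ∉ S := fun hv => by
    obtain ⟨l, hd⟩ := h.docked v hv
    rw [hc.lock_of_dockedAt l v hd] at hl
    rcases hl with hl | hl
    · cases hl
    · exact hj (Option.some.inj hl ▸ hd.2)
  have hdocked : ∀ l x, (HelpingAsync.stepDock j v c).DockedAt l x →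
      l = j ∧ x = v ∨ l ≠ j ∧ c.DockedAt l x := fun l x hd => by
    by_cases hlj : l = j
    · subst hlj
      exact .inl ⟨rfl, Option.some.inj (hd.1.symm.trans hp)⟩
    · exact .inr ⟨hlj, by simpa [HelpingAsync.stepDock, DockedAt, hlj] using hd⟩
  constructor
  case docked =>
    intro x hx
    obtain ⟨l, hd⟩ := h.docked x hx
    have hlj : l ≠ j := fun hlj => hj (hlj ▸ hd.2)
    exact ⟨l, by simpa [HelpingAsync.stepDock, DockedAt, hlj] using hd⟩
  case visited =>
    intro l x hd
    rcases hdocked l x hd with ⟨rfl, rfl⟩ | ⟨hlj, hd⟩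
    · simp [HelpingAsync.stepDock, hv]
    · simpa [HelpingAsync.stepDock, hlj] using h.visited l x hd
  case entryPort =>
    intro l x hd hx
    rcases hdocked l x hd with ⟨rfl, rfl⟩ | ⟨hlj, hd⟩
    · exact absurd hx hv
    · simpa [HelpingAsync.stepDock, hlj] using h.entryPort l x hd hx

theorem stepHelp (h : c.Records i S par) (hc : c.Sound) (hd : c.DockedAt j v)
    (hw : c.WaitsAt i v) (hpar : ∀ x ∈ S, par' x = par x)
    (hv : v ∉ S → par' v = (c.mem i).portEntered) :
    (stepHelp j v c).Records i (insert v S) par' := by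
  have hdocked : ∀ l x, (HelpingAsync.stepHelp j v c).DockedAt l x ↔ c.DockedAt l x :=
    fun l x => by rw [DockedAt, stepHelp_state]; rfl
  have hother : ∀ l x, c.DockedAt l x → x ≠ v →
      (HelpingAsync.stepHelp j v c).mem l = c.mem l := fun l x hl hx =>
    stepHelp_mem_of_not_waitsAt
      (fun hlj => hx (Option.some.inj (hl.1.symm.trans (hlj ▸ hd.1))))
      (fun hwl => hwl.2.1 hl.2)
  constructor
  case docked =>
    intro x hx
    simp only [hdocked]
    rcases Finset.mem_insert.1 hx with rfl | hx
    · exact ⟨j, hd⟩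
    · exact h.docked x hx
  case visited =>
    intro l x hl
    rw [hdocked] at hl
    by_cases hx : x = v
    · subst hx
      obtain rfl := hc.dockedAt_unique hl hd
      simpa [HelpingAsync.stepHelp] using .inr hw
    · simp [hother l x hl hx, h.visited l x hl, hx]
  case entryPort =>
    intro l x hl hx
    rw [hdocked] at hl
    by_cases hxv : x = v
    · subst hxv
      obtain rfl := hc.dockedAt_unique hl hd
      have hvisited := h.visited l x hd
      by_cases hxS : x ∈ S
      · simp [HelpingAsync.stepHelp, hvisited, hxS, h.entryPort l x hl hxS, hpar x hxS]
      · simp [HelpingAsync.stepHelp, hvisited, hxS, hw, hv hxS]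
    · have hxS := (Finset.mem_insert.1 hx).resolve_left hxv
      rw [hother l x hl hxv, h.entryPort l x hl hxS, hpar x hxS]

theorem transition [Fintype V] {G : SimpleGraph V} [DecidableRel G.Adj] {L : PortLabeling G}
    (h : c.Records i S par) (hc : c.Sound) (hst : Transition L j c c')
    (hw : ∀ v, c.DockedAt j v → ¬ c.WaitsAt i v) : c'.Records i S par := by
  by_cases hdock : (c'.mem j).state = .settled ∧ (c.mem j).state ≠ .settled
  · obtain ⟨v, hp, hl, rfl⟩ := hst.eq_stepDock hdock.2 hdock.1
    exact h.stepDock hc hp hdock.2 hl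
  · refine h.congr (fun l v => hst.dockedAt_iff hc fun hs => ?_) fun l v hl => ?_
    · exact not_not.1 (not_and.1 hdock hs)
    · rcases eq_or_ne l j with rfl | hlj
      · rw [hst.eq_stepHelp hl]
        simp [HelpingAsync.stepHelp, hw v hl]
      · rw [hst.mem_of_ne hlj fun v _ hwl => hwl.2.1 hl.2]
        exact ⟨rfl, rfl⟩

end Config.Records

end Records

section Arrival

variable {V : Type u} {k : ℕ}

/-- Robot `i` is on its way to node `u`, or it is there and has not yet received a message of the
robot that docks there. Here `S` is the set of the nodes that it has visited before, and `entry` is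
the port through which it enters. -/
inductive Config.Arriving (c : Config V k) (i : Fin k) (S : Finset V) (u : V) : Option ℕ → Prop
  | transit (e : ℕ) (hp : c.place i = .transit u e) : c.Arriving i S u (some e)
  | start (entry : Option ℕ) (hp : c.place i = .at u entry) (hph : (c.mem i).phase = .start)
      (hpe : entry = none → (c.mem i).portEntered = -1) : c.Arriving i S u entry
  | contend (entry : Option ℕ) (hp : c.place i = .at u entry) (hph : (c.mem i).phase = .contend)
      (hpe : (c.mem i).portEntered = entry.elim (-1) (↑)) (hu : u ∉ S) : c.Arriving i S u entry
  | await (entry : Option ℕ) (lost : Bool) (hp : c.place i = .at u entry)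
      (hph : (c.mem i).phase = .await lost) (hpe : (c.mem i).portEntered = entry.elim (-1) (↑))
      (r : Fin k) (hl : c.lock u = some r) (hu : lost = true → u ∉ S) :
      c.Arriving i S u entry

/-- Robot `i` departs from a node in a step from `c` to `c'`. -/
abbrev Departs (c c' : Config V k) (i : Fin k) : Prop :=
  (c.place i).node?.isSome = true ∧ (c'.place i).node? = none

variable {c c' : Config V k} {i j : Fin k} {u v : V} {S : Finset V} {entry : Option ℕ}

theorem departs_of_eq_transit {e : ℕ} (hp : c.place i = .at u entry)
    (hp' : c'.place i = .transit v e) : Departs c c' i := by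
  simp [Departs, hp, hp', Place.node?]

namespace Config.Arriving

theorem phase_ne_act (h : c.Arriving i S u entry) (hc : c.Sound) (lost : Bool) :
    (c.mem i).phase ≠ .act lost := by
  cases h with
  | transit e hp => simp [hc.phase_of_transit i u e hp]
  | start _ _ hph | contend _ _ hph | await _ _ _ hph => simp [hph]

theorem of_waitsAt (h : c.Arriving i S u entry) (hw : c.WaitsAt i v) :
    u = v ∧ c.place i = .at u entry ∧ (c.mem i).portEntered = entry.elim (-1) (↑) ∧
      ((c.mem i).phase = .await true → u ∉ S) := by
  obtain ⟨hv, -, hw⟩ := hw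
  cases h with
  | transit e hp => rw [hp] at hv; cases hv
  | start _ _ hph | contend _ _ hph => simp [Config.Waits, hph] at hw
  | await _ lost hp hph hpe _ _ hu =>
    rw [hp] at hv
    refine ⟨Option.some.inj hv, hp, hpe, fun hlost => hu ?_⟩
    exact Phase.await.inj (hph.symm.trans hlost)

theorem exists_waitsAt (h : c.Arriving i S u entry) (hc : c.Sound)
    (hs : (c.mem i).state ≠ .settled) (hw : c.Waits i) :
    c.WaitsAt i u ∧ ∃ r, c.lock u = some r := by
  cases h with
  | transit e hp => simp [Config.Waits, hc.phase_of_transit i u e hp] at hw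
  | start _ _ hph | contend _ _ hph => simp [Config.Waits, hph] at hw
  | await _ _ hp _ _ r hl => exact ⟨⟨by rw [hp]; rfl, hs, hw⟩, r, hl⟩

theorem congr (h : c.Arriving i S u entry) (hp : c'.place i = c.place i)
    (hm : c'.mem i = c.mem i) (hl : ∀ r, c.lock u = some r → c'.lock u = some r) :
    c'.Arriving i S u entry := by
  cases h with
  | transit e hp' => exact .transit e (hp.trans hp')
  | start _ hp' => exact .start _ (hp.trans hp') (by rwa [hm]) (by rwa [hm])
  | contend _ hp' hph hpe hu => exact .contend _ (hp.trans hp') (by rwa [hm]) (by rwa [hm]) hu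
  | await _ lost hp' hph hpe r hlr hu =>
    exact .await _ lost (hp.trans hp') (by rwa [hm]) (by rwa [hm]) r (hl r hlr) hu

variable [DecidableEq V]

theorem stepStart (hp : c.place i = .at u entry) (hpe : entry = none → (c.mem i).portEntered = -1)
    (hc : c.Sound) (hS : ∀ x ∈ S, ∃ j, c.DockedAt j x)
    (hb : (c.mem i).state = .backtrack → u ∈ S) :
    (stepStart i u entry c).Arriving i S u entry := by
  have hportEntered :
      ((HelpingAsync.stepStart i u entry c).mem i).portEntered = entry.elim (-1) (↑) := by
    cases entry with
    | none => simpa [HelpingAsync.stepStart] using hpe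
    | some e => simp [HelpingAsync.stepStart]
  have hphase : ((HelpingAsync.stepStart i u entry c).mem i).phase =
      if (c.mem i).state = .backtrack ∨ ∃ j, c.DockedAt j u then .await false else .contend := by
    simp [HelpingAsync.stepStart]
  split_ifs at hphase with hd
  · obtain ⟨r, hr⟩ : ∃ j, c.DockedAt j u := hd.elim (fun h => hS u (hb h)) id
    exact .await _ false hp hphase hportEntered r
      (hc.lock_of_dockedAt r u hr) nofun
  · exact .contend _ hp hphase hportEntered fun hu => hd (.inr (hS u hu))

variable [Fintype V] {G : SimpleGraph V} [DecidableRel G.Adj] {L : PortLabeling G}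

theorem transition (h : c.Arriving i S u entry) (hc : c.Sound)
    (hs : (c.mem i).state ≠ .settled) (hS : ∀ x ∈ S, ∃ j, c.DockedAt j x)
    (hb : (c.mem i).state = .backtrack → u ∈ S) (hst : Transition L i c c')
    (hs' : (c'.mem i).state ≠ .settled) : c'.Arriving i S u entry := by
  cases h with
  | transit e hp =>
    have hph := hc.phase_of_transit i u e hp
    obtain rfl := hst.eq_of_transit hp
    exact .start _ (Function.update_self ..) hph nofun
  | start _ hp hph hpe =>
    obtain rfl := hst.eq_stepStart hp hs hph
    exact stepStart hp hpe hc hS hb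
  | contend _ hp hph hpe hu =>
    obtain ⟨r, -, rfl⟩ := hst.eq_stepLose hp hph hs'
    exact .await _ true hp (by simp [stepLose]) (by simpa [stepLose] using hpe) r
      (by simp [stepLose]) fun _ => hu
  | await _ lost hp hph hpe r hl hu =>
    obtain rfl := hst.eq_self_of_waits hc hs (by cases lost <;> simp [Config.Waits, hph])
    exact .await _ lost hp hph hpe r hl hu

end Config.Arriving

variable [Fintype V] [DecidableEq V] {G : SimpleGraph V} [DecidableRel G.Adj]
  {L : PortLabeling G}

theorem Transition.not_departs (h : Transition L i c c')
    (hact : ∀ lost, (c.mem i).phase ≠ .act lost) : ¬ Departs c c' i := by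
  rintro ⟨hn, hn'⟩
  cases h with
  | act _ _ lost _ _ hph => exact hact lost hph
  | arrive => simp [Place.node?] at hn'
  | _ => exact Option.isSome_iff_ne_none.1 hn hn'

theorem Transition.state_eq (h : Transition L i c c') (hs' : (c'.mem i).state ≠ .settled)
    (hact : ∀ lost, (c.mem i).phase ≠ .act lost) : (c'.mem i).state = (c.mem i).state := by
  cases h with
  | act _ _ lost _ _ hph => exact absurd hph (hact lost)
  | arrive | idle => rfl
  | help => exact stepHelp_state i
  | start _ e => cases e <;> simp [stepStart]
  | dock => simp [stepDock] at hs'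
  | lose => simp [stepLose]

end Arrival

section Search

variable {V : Type u} [Fintype V] [DecidableEq V] {G : SimpleGraph V} [DecidableRel G.Adj] {k : ℕ}

/-- The undocked robot `i` carries out a depth-first search and has made the given number of moves.
It is on its way to its first node (`fresh`), to the node behind the next port (`exploring`), or
back along its path (`backtracking`); or it has received a message and is about to go back from a
node that it had visited before (`returning`), or to go on from the end of its path (`leaving`). -/
inductive Searching (L : PortLabeling G) (c : Config V k) (i : Fin k) : ℕ → Prop
  | fresh (u : V) (par : V → ℤ) (hs : (c.mem i).state = .explore) (ha : c.Arriving i ∅ u none)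
      (hr : c.Records i ∅ par) : Searching L c i 0
  | exploring (m : ℕ) (D : Trace V) (e : ℕ) (hD : D.IsDfs L m) (hskip : D.skip.IsScan G)
      (he : (e : ℤ) = L.portTo (D.nextNode L) D.top) (hs : (c.mem i).state = .explore)
      (ha : c.Arriving i D.seen (D.nextNode L) (some e))
      (hr : c.Records i D.seen fun v => L.portTo v (D.parent v)) : Searching L c i (m + 1)
  | backtracking (m : ℕ) (D : Trace V) (e : ℕ) (hD : D.IsDfs L m)
      (he : (e : ℤ) = D.nthPort L D.top (D.off D.top)) (hs : (c.mem i).state = .backtrack)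
      (ha : c.Arriving i D.seen D.top (some e))
      (hr : c.Records i D.seen fun v => L.portTo v (D.parent v)) : Searching L c i m
  | returning (m : ℕ) (D : Trace V) (entry : Option ℕ) (hD : D.IsDfs L m)
      (hskip : D.skip.IsScan G) (hnext : D.nextNode L ∈ D.seen) (hs : (c.mem i).state = .explore)
      (hseen : (c.mem i).seen = true) (hph : (c.mem i).phase = .act false)
      (hp : c.place i = .at (D.nextNode L) entry)
      (hpe : (c.mem i).portEntered = L.portTo (D.nextNode L) D.top)
      (hr : c.Records i D.seen fun v => L.portTo v (D.parent v)) : Searching L c i (m + 1)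
  | leaving (m : ℕ) (D : Trace V) (lost : Bool) (entry : Option ℕ) (hD : D.IsDfs L m)
      (hph : (c.mem i).phase = .act lost)
      (hn : ¬((c.mem i).state = .explore ∧ (c.mem i).seen = true ∧ lost = false))
      (hp : c.place i = .at D.top entry)
      (hpp : (c.mem i).parentPtr = L.portTo D.top (D.parent D.top))
      (hpe : ((c.mem i).portEntered + 1) % (G.degree D.top : ℤ) = D.next L)
      (hr : c.Records i D.seen fun v => L.portTo v (D.parent v)) : Searching L c i m

variable {L : PortLabeling G} {c c' : Config V k} {i j : Fin k} {v : V} {m : ℕ}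
  {entry : Option ℕ} {lost : Bool} {D : Trace V}

theorem stepAct_of_returns
    (h : (c.mem i).state = .explore ∧ (c.mem i).seen = true ∧ lost = false) :
    stepAct L i v entry lost c = { c with
      mem := Function.update c.mem i { c.mem i with phase := .start, state := .backtrack }
      place := Function.update c.place i (depart L v entry (c.mem i).portEntered) } := by
  simp only [stepAct, if_pos h]

theorem stepAct_of_not_returns
    (h : ¬((c.mem i).state = .explore ∧ (c.mem i).seen = true ∧ lost = false)) :
    stepAct L i v entry lost c = { c with
      mem := Function.update c.mem i { c.mem i with
        phase := .start
        portEntered := ((c.mem i).portEntered + 1) % (G.degree v : ℤ)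
        state := if ((c.mem i).portEntered + 1) % (G.degree v : ℤ) = (c.mem i).parentPtr
          then .backtrack else .explore }
      place := Function.update c.place i
        (depart L v entry (((c.mem i).portEntered + 1) % (G.degree v : ℤ))) } := by
  simp only [stepAct, if_neg h]

namespace Searching

theorem stepAct_returning (hD : D.IsDfs L m) (hI : D.next L ∈ Set.Ico 0 (G.degree D.top : ℤ))
    (hskip : D.skip.IsScan G) (hnext : D.nextNode L ∈ D.seen)
    (hret : (c.mem i).state = .explore ∧ (c.mem i).seen = true ∧ lost = false)
    (hp : c.place i = .at (D.nextNode L) entry)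
    (hpe : (c.mem i).portEntered = L.portTo (D.nextNode L) D.top)
    (hr : (stepAct L i (D.nextNode L) entry lost c).Records i D.seen
      fun v => L.portTo v (D.parent v)) :
    Searching L (stepAct L i (D.nextNode L) entry lost c) i (m + 2) ∧
      Departs c (stepAct L i (D.nextNode L) entry lost c) i := by
  have hadj : G.Adj D.top (D.nextNode L) := adj_neighbor hI
  have hport : L.portTo D.top (D.nextNode L) = D.next L := portTo_neighbor hI
  rw [stepAct_of_returns hret, hpe, depart_of_mem_Ico _ (portTo_mem_Ico hadj.symm),
    neighbor_portTo hadj.symm, hport] at hr ⊢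
  refine ⟨.backtracking (m + 2) D.skip (D.next L).toNat (hD.skip hskip hnext) ?_ (by simp)
    (.transit _ (Function.update_self ..)) hr, departs_of_eq_transit hp (Function.update_self ..)⟩
  change _ = D.nthPort L D.top (D.skip.off D.top)
  rw [Int.toNat_of_nonneg hI.1, Trace.skip_off_top, Trace.next]

theorem stepAct_leaving (hD : D.IsDfs L m) (hG : G.Connected) (hu : D.seen ≠ Finset.univ)
    (hn : ¬((c.mem i).state = .explore ∧ (c.mem i).seen = true ∧ lost = false))
    (hp : c.place i = .at D.top entry)
    (hpp : (c.mem i).parentPtr = L.portTo D.top (D.parent D.top))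
    (hpe : ((c.mem i).portEntered + 1) % (G.degree D.top : ℤ) = D.next L)
    (hr : (stepAct L i D.top entry lost c).Records i D.seen fun v => L.portTo v (D.parent v)) :
    Searching L (stepAct L i D.top entry lost c) i (m + 1) ∧
      Departs c (stepAct L i D.top entry lost c) i := by
  have hI := hD.next_mem_Ico hG hu
  have hport := portTo_mem_Ico (L := L) (adj_neighbor (L := L) hI).symm
  rw [stepAct_of_not_returns hn, hpe, hpp, depart_of_mem_Ico _ hI] at hr ⊢
  refine ⟨?_, departs_of_eq_transit hp (Function.update_self ..)⟩
  by_cases hback : D.next L = L.portTo D.top (D.parent D.top)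
  · have hnode : L.neighbor D.top (D.next L) = D.parent D.top := hD.nextNode_eq_parent hback
    have hroot := hD.top_ne_root hback
    rw [hnode] at hport
    refine .backtracking (m + 1) D.close (L.portTo (D.parent D.top) D.top).toNat (hD.close hback)
      ?_ (by simp [hback]) (.transit _ ?_) hr
    · rw [Int.toNat_of_nonneg hport.1]
      exact hD.portTo_parent _ hD.top_mem hroot hD.top_open
    · simp only [Function.update_self, hnode]
      rfl
  · exact .exploring m D _ hD (hD.isScan_skip hG hu hback) (Int.toNat_of_nonneg hport.1)
      (by simp [hback]) (.transit _ (Function.update_self ..)) hr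

theorem transition_act (h : Searching L c i m) (hG : G.Connected) (hk : k ≤ Fintype.card V)
    (hc : c.Sound) (hs : (c.mem i).state ≠ .settled) (hst : Transition L i c c')
    (hact : (c.mem i).phase = .act lost) : Searching L c' i (m + 1) ∧ Departs c c' i := by
  have hrec {S par} (hr : c.Records i S par) : c'.Records i S par :=
    hr.transition hc hst fun v hd => absurd hd.2 hs
  cases h with
  | fresh _ _ _ ha | exploring _ _ _ _ _ _ _ ha | backtracking _ _ _ _ _ _ ha =>
    exact absurd hact (ha.phase_ne_act hc lost)
  | returning m D entry hD hskip hnext hse hseen hph hp hpe hr =>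
    have hI := hD.next_mem_Ico hG (hr.ne_univ hs hk)
    obtain rfl := hst.eq_stepAct hp hs hph
    exact stepAct_returning hD hI hskip hnext ⟨hse, hseen, rfl⟩ hp hpe (hrec hr)
  | leaving _ D lost entry hD hph hn hp hpp hpe hr =>
    obtain rfl := hst.eq_stepAct hp hs hph
    exact stepAct_leaving hD hG (hr.ne_univ hs hk) hn hp hpp hpe (hrec hr)

theorem transition_of_phase_ne_act (h : Searching L c i m) (hc : c.Sound)
    (hs : (c.mem i).state ≠ .settled) (hst : Transition L i c c')
    (hs' : (c'.mem i).state ≠ .settled) (hact : ∀ lost, (c.mem i).phase ≠ .act lost) :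
    Searching L c' i m := by
  have hrec {S par} (hr : c.Records i S par) : c'.Records i S par :=
    hr.transition hc hst fun v hd => absurd hd.2 hs
  have hstate := hst.state_eq hs' hact
  cases h with
  | fresh u par he ha hr =>
    exact .fresh u par (hstate.trans he)
      (ha.transition hc hs hr.docked (by simp [he]) hst hs') (hrec hr)
  | exploring m D e hD hskip he hse ha hr =>
    exact .exploring m D e hD hskip he (hstate.trans hse)
      (ha.transition hc hs hr.docked (by simp [hse]) hst hs') (hrec hr)
  | backtracking _ D e hD he hsb ha hr =>
    exact .backtracking m D e hD he (hstate.trans hsb)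
      (ha.transition hc hs hr.docked (fun _ => hD.top_mem) hst hs') (hrec hr)
  | returning _ _ _ _ _ _ _ _ hph => exact absurd hph (hact false)
  | leaving _ _ lost _ _ hph => exact absurd hph (hact lost)

theorem stepHelp_fresh (hc : c.Sound) (hd : c.DockedAt j v) (hw : c.WaitsAt i v) {u : V}
    {par : V → ℤ} (hs : (c.mem i).state = .explore) (ha : c.Arriving i ∅ u none)
    (hr : c.Records i ∅ par) : Searching L (stepHelp j v c) i 0 := by
  have hij : i ≠ j := fun h => hw.2.1 (h ▸ hd.2)
  obtain ⟨rfl, hp, hpe, -⟩ := ha.of_waitsAt hw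
  have hvis : (c.mem j).visited i = false := by simpa using hr.visited j u hd
  have hrec : (HelpingAsync.stepHelp j u c).Records i {u} fun x => L.portTo x u :=
    hr.stepHelp hc hd hw (by simp) fun _ => by rw [hpe, portTo_self]; rfl
  have hmem := stepHelp_mem_of_waitsAt hij hw
  rw [hvis] at hmem
  refine .leaving 0 (.init u) _ none (Trace.isDfs_init L u) (by rw [hmem]) ?_ hp ?_ ?_ hrec
  · simp [hmem]
  · simp [hmem, hs, hpe, Trace.init, portTo_self]
  · simp [hmem, hpe, Trace.init, Trace.next, Trace.nthPort, portTo_self]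

theorem stepHelp_exploring (hG : G.Connected) (hc : c.Sound) (hd : c.DockedAt j v)
    (hw : c.WaitsAt i v) {e : ℕ} (hD : D.IsDfs L m) (hskip : D.skip.IsScan G)
    (he : (e : ℤ) = L.portTo (D.nextNode L) D.top) (hs : (c.mem i).state = .explore)
    (ha : c.Arriving i D.seen (D.nextNode L) (some e))
    (hr : c.Records i D.seen fun v => L.portTo v (D.parent v)) :
    Searching L (stepHelp j v c) i (m + 1) := by
  have hij : i ≠ j := fun h => hw.2.1 (h ▸ hd.2)
  obtain ⟨rfl, hp, hpe, hlost⟩ := ha.of_waitsAt hw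
  rw [Option.elim_some, he] at hpe
  have hmem := stepHelp_mem_of_waitsAt hij hw
  by_cases hseen : D.nextNode L ∈ D.seen
  · have hrec := hr.stepHelp (par' := fun v => L.portTo v (D.parent v)) hc hd hw (fun _ _ => rfl)
      (absurd hseen)
    rw [Finset.insert_eq_of_mem hseen] at hrec
    have hvis : (c.mem j).visited i = true := by simpa [hseen] using hr.visited j _ hd
    have hph : (c.mem i).phase ≠ .await true := fun hph => hlost hph hseen
    exact .returning m D (some e) hD hskip hseen (by rw [hmem, hs]) (by rw [hmem, hvis])
      (by simp [hmem, hph]) hp (by rw [hmem, hpe]) hrec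
  · have hvis : (c.mem j).visited i = false := by simpa [hseen] using hr.visited j _ hd
    rw [hvis] at hmem
    have hne {x} (hx : x ∈ D.seen) : x ≠ D.nextNode L := fun h => hseen (h ▸ hx)
    have hrec : (HelpingAsync.stepHelp j (D.nextNode L) c).Records i (D.extend (D.nextNode L)).seen
        fun v => L.portTo v ((D.extend (D.nextNode L)).parent v) :=
      hr.stepHelp hc hd hw (fun x hx => by rw [Trace.extend_parent_of_ne (hne hx)])
        fun _ => by rw [Trace.extend_parent_self, hpe]
    have hparent : (D.extend (D.nextNode L)).parent (D.nextNode L) = D.top :=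
      Trace.extend_parent_self
    have hoff : (D.extend (D.nextNode L)).off (D.nextNode L) = 0 := hskip.off_eq_zero _ hseen
    have htop : (D.extend (D.nextNode L)).top = D.nextNode L := rfl
    refine .leaving (m + 1) (D.extend (D.nextNode L)) _ (some e) (hD.extend hG hskip hseen)
      (by rw [hmem]) (by simp [hmem]) hp ?_ ?_ hrec
    · rw [htop, hparent, hmem]
      simp [hs, hpe]
    · rw [htop, hmem, hpe, Trace.next, Trace.nthPort, htop, hparent, hoff, zero_add, Nat.cast_one]

theorem stepHelp_backtracking (hc : c.Sound) (hd : c.DockedAt j v) (hw : c.WaitsAt i v) {e : ℕ}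
    (hD : D.IsDfs L m) (he : (e : ℤ) = D.nthPort L D.top (D.off D.top))
    (hs : (c.mem i).state = .backtrack) (ha : c.Arriving i D.seen D.top (some e))
    (hr : c.Records i D.seen fun v => L.portTo v (D.parent v)) :
    Searching L (stepHelp j v c) i m := by
  have hij : i ≠ j := fun h => hw.2.1 (h ▸ hd.2)
  obtain ⟨rfl, hp, hpe, -⟩ := ha.of_waitsAt hw
  rw [Option.elim_some, he] at hpe
  have hmem := stepHelp_mem_of_waitsAt hij hw
  have hrec := hr.stepHelp (par' := fun v => L.portTo v (D.parent v)) hc hd hw (fun _ _ => rfl)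
    (absurd hD.top_mem)
  rw [Finset.insert_eq_of_mem hD.top_mem] at hrec
  refine .leaving m D _ (some e) hD (by rw [hmem]) (by simp [hmem, hs]) hp ?_ ?_
    hrec
  · simp [hmem, hs, hr.entryPort j _ hd hD.top_mem]
  · rw [hmem, hpe, Trace.next, Trace.nthPort, Trace.nthPort, Int.emod_add_emod, Nat.cast_succ,
      add_assoc]

theorem stepHelp (h : Searching L c i m) (hG : G.Connected) (hc : c.Sound)
    (hd : c.DockedAt j v) (hw : c.WaitsAt i v) : Searching L (stepHelp j v c) i m := by
  cases h with
  | fresh _ _ hs ha hr => exact stepHelp_fresh hc hd hw hs ha hr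
  | exploring _ _ _ hD hskip he hs ha hr =>
    exact stepHelp_exploring hG hc hd hw hD hskip he hs ha hr
  | backtracking _ _ _ hD he hs ha hr => exact stepHelp_backtracking hc hd hw hD he hs ha hr
  | returning _ _ _ _ _ _ _ _ hph | leaving _ _ _ _ _ hph =>
    exact absurd hw.2.2 (by simp [Config.Waits, hph])

theorem congr (h : Searching L c i m) (hp : c'.place i = c.place i) (hm : c'.mem i = c.mem i)
    (hl : ∀ v r, c.lock v = some r → c'.lock v = some r)
    (hrec : ∀ S par, c.Records i S par → c'.Records i S par) : Searching L c' i m := by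
  cases h with
  | fresh u par hs ha hr => exact .fresh u par (by rwa [hm]) (ha.congr hp hm (hl _)) (hrec _ _ hr)
  | exploring m D e hD hskip he hs ha hr =>
    exact .exploring m D e hD hskip he (by rwa [hm]) (ha.congr hp hm (hl _)) (hrec _ _ hr)
  | backtracking _ D e hD he hs ha hr =>
    exact .backtracking m D e hD he (by rwa [hm]) (ha.congr hp hm (hl _)) (hrec _ _ hr)
  | returning m D entry hD hskip hnext hs hseen hph hp' hpe hr =>
    rw [← hm] at hs hseen hph hpe
    exact .returning m D entry hD hskip hnext hs hseen hph (hp.trans hp') hpe (hrec _ _ hr)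
  | leaving _ D lost entry hD hph hn hp' hpp hpe hr =>
    rw [← hm] at hph hn hpp hpe
    exact .leaving m D lost entry hD hph hn (hp.trans hp') hpp hpe (hrec _ _ hr)

theorem transition_of_ne (h : Searching L c i m) (hG : G.Connected) (hc : c.Sound) (hij : i ≠ j)
    (hst : Transition L j c c') : Searching L c' i m := by
  by_cases hw : ∃ v, c.DockedAt j v ∧ c.WaitsAt i v
  · obtain ⟨v, hd, hw⟩ := hw
    rw [hst.eq_stepHelp hd]
    exact h.stepHelp hG hc hd hw
  · have hw' : ∀ v, c.DockedAt j v → ¬ c.WaitsAt i v := fun v hd hwi => hw ⟨v, hd, hwi⟩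
    exact h.congr (hst.place_of_ne hij) (hst.mem_of_ne hij hw') (fun _ _ => hst.lock)
      fun _ _ hr => hr.transition hc hst hw'

end Searching

end Search

/-! ### Counting and dispersion -/

section Stage

variable {V : Type u} {k : ℕ} {c : Config V k} {i : Fin k}

/-- An upper bound on the number of active steps of robot `i` since its last move, if it has not
docked. -/
def stage (c : Config V k) (i : Fin k) : ℕ :=
  if (c.place i).node? = none then 0
  else match (c.mem i).phase with
    | .start => 1
    | .contend => 2
    | _ => 3

theorem stage_le : stage c i ≤ 3 := by
  unfold stage
  split_ifs
  · omega
  · split <;> omega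

theorem Config.Sound.stage_eq (hc : c.Sound) (hs : (c.mem i).state = .settled) :
    stage c i = 3 := by
  obtain ⟨v, hn, -⟩ := hc.exists_dockedAt hs
  simp [stage, hn, (hc.settled_iff i).1 hs]

end Stage

section Dispersion

variable {V : Type u} [Fintype V] [DecidableEq V] {G : SimpleGraph V} [DecidableRel G.Adj] {k : ℕ}
variable {L : PortLabeling G} {c c' : Config V k} {i j : Fin k} {v : V} {m : ℕ}

theorem searching_init (L : PortLabeling G) (s : Fin k → V) (i : Fin k) :
    Searching L (Config.init s) i 0 := by
  refine .fresh (s i) (fun _ => 0) rfl (.start none rfl rfl fun _ => rfl) ⟨?_, ?_, ?_⟩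
  all_goals simp [Config.init, Memory.init]

theorem Searching.moves_le (h : Searching L c i m) (hG : G.Connected) :
    m + 2 * (Fintype.card V - 1) ≤ 4 * G.edgeFinset.card := by
  cases h with
  | fresh u => exact (Trace.isDfs_init L u).moves_le hG
  | backtracking _ _ _ hD | leaving _ _ _ _ hD => exact hD.moves_le hG
  | exploring _ _ _ hD hskip | returning _ _ _ hD hskip => exact hD.succ_moves_le hG hskip

theorem Searching.exists_waitsAt (h : Searching L c i m) (hc : c.Sound)
    (hs : (c.mem i).state ≠ .settled) (hw : c.Waits i) :
    ∃ u, c.WaitsAt i u ∧ ∃ r, c.lock u = some r := by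
  cases h with
  | fresh _ _ _ ha | exploring _ _ _ _ _ _ _ ha | backtracking _ _ _ _ _ _ ha =>
    exact ⟨_, ha.exists_waitsAt hc hs hw⟩
  | returning _ _ _ _ _ _ _ _ hph | leaving _ _ _ _ _ hph => simp [Config.Waits, hph] at hw

namespace Transition

theorem settled (h : Transition L j c c') (hc : c.Sound) (hs : (c.mem i).state = .settled) :
    (c'.mem i).state = .settled :=
  have ⟨_, hd⟩ := hc.exists_dockedAt hs
  (h.dockedAt hd).2

theorem stage_le_of_ne (h : Transition L j c c') (hij : i ≠ j) : stage c i ≤ stage c' i := by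
  by_cases hw : ∃ v, c.DockedAt j v ∧ c.WaitsAt i v
  · obtain ⟨v, hd, hw⟩ := hw
    have hn : ((stepHelp j v c).place i).node? = some v := hw.1
    rw [h.eq_stepHelp hd]
    calc stage c i ≤ 3 := stage_le
      _ = stage (stepHelp j v c) i := by simp [stage, hn, stepHelp_mem_of_waitsAt hij hw]
  · rw [stage, stage, h.place_of_ne hij, h.mem_of_ne hij fun v hd hwi => hw ⟨v, hd, hwi⟩]

theorem stage_lt (h : Transition L i c c') (hc : c.Sound) (hs : (c.mem i).state ≠ .settled)
    (hw : ¬ c.Waits i) (hact : ∀ lost, (c.mem i).phase ≠ .act lost) :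
    stage c i < stage c' i := by
  cases h with
  | arrive v p hp => simp [stage, hp, hc.phase_of_transit i v p hp, Place.node?]
  | help _ _ _ hs' => exact absurd hs' hs
  | start v e hp _ hph =>
    simp only [stage, stepStart, hp, hph, Place.node?, Function.update_self]
    split_ifs <;> simp_all
  | dock v e hp _ hph => simp [stage, stepDock, hp, hph, Place.node?]
  | lose v e hp _ hph => simp [stage, stepLose, hp, hph, Place.node?]
  | act _ _ lost _ _ hph => exact absurd hph (hact lost)
  | idle _ _ _ _ hph => exact absurd ((hc.settled_iff i).2 (hph.resolve_left hw)) hs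

theorem place_of_waitsAt (h : Transition L j c c') (hc : c.Sound) (hw : c.WaitsAt i v) :
    c'.place i = c.place i := by
  rcases eq_or_ne i j with rfl | hij
  · rw [h.eq_self_of_waits hc hw.2.1 hw.2.2]
  · exact h.place_of_ne hij

theorem dockedAt_of_lock (h : Transition L i c c') (hc : c.Sound) (hl : c.lock v = some i) :
    c'.DockedAt i v := by
  obtain ⟨hn, hph⟩ := hc.of_lock i v hl
  by_cases hs : (c.mem i).state = .settled
  · exact h.dockedAt ⟨hn, hs⟩
  · obtain ⟨e, hp⟩ := Place.node?_eq_some_iff.1 hn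
    have hph := hph.resolve_left fun hhelp => hs ((hc.settled_iff i).2 hhelp)
    have hs' : (c'.mem i).state = .settled := by
      by_contra hs'
      obtain ⟨r, hr, rfl⟩ := h.eq_stepLose hp hph hs'
      exact hr (by simpa [stepLose] using h.lock hl)
    obtain ⟨_, -, -, rfl⟩ := h.eq_stepDock hs hs'
    exact ⟨hn, hs'⟩

theorem not_waits_of_dockedAt (h : Transition L j c c') (hd : c.DockedAt j v)
    (hw : c.WaitsAt i v) : ¬ c'.Waits i := by
  have hij : i ≠ j := fun hij => hw.2.1 (hij ▸ hd.2)
  rw [h.eq_stepHelp hd, Config.Waits, stepHelp_mem_of_waitsAt hij hw]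
  simp

end Transition

variable {s : Fin k → V} {sched choice : ℕ → Fin k}

theorem moves_succ (i : Fin k) (t : ℕ) : moves L s sched choice i (t + 1) =
    moves L s sched choice i t + if sched t = i ∧ Departs (run L s sched choice t)
      (run L s sched choice (t + 1)) i then 1 else 0 := by
  simp only [moves, Finset.card_filter, Finset.sum_range_succ]

theorem activeSteps_succ (i : Fin k) (t : ℕ) : activeSteps L s sched choice i (t + 1) =
    activeSteps L s sched choice i t +
      if sched t = i ∧ ((run L s sched choice t).mem i).state ≠ .settled ∧
        ¬ (run L s sched choice t).Waits i then 1 else 0 := by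
  simp only [activeSteps, Finset.card_filter, Finset.sum_range_succ]

theorem searching_run (hG : G.Connected) (hk : k ≤ Fintype.card V) (i : Fin k) (t : ℕ)
    (hs : ((run L s sched choice t).mem i).state ≠ .settled) :
    Searching L (run L s sched choice t) i (moves L s sched choice i t) := by
  induction t with
  | zero => exact searching_init L s i
  | succ t ih =>
    have hst := transition_run L s sched choice t
    have hc := sound_run L s sched choice t
    have hs' : ((run L s sched choice t).mem i).state ≠ .settled := fun h => hs (hst.settled hc h)
    rw [moves_succ]
    by_cases hi : sched t = i
    · rw [hi] at hst
      by_cases hact : ∃ lost, ((run L s sched choice t).mem i).phase = .act lost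
      · obtain ⟨lost, hact⟩ := hact
        have ⟨hsearch, hdep⟩ := (ih hs').transition_act hG hk hc hs' hst hact
        rwa [if_pos ⟨hi, hdep⟩]
      · rw [not_exists] at hact
        rw [if_neg fun h => hst.not_departs hact h.2]
        exact (ih hs').transition_of_phase_ne_act hc hs' hst hs hact
    · rw [if_neg fun h => hi h.1]
      exact (ih hs').transition_of_ne hG hc (Ne.symm hi) hst

theorem moves_le (hG : G.Connected) (hk : k ≤ Fintype.card V) (i : Fin k) (t : ℕ) :
    moves L s sched choice i t + 2 * (Fintype.card V - 1) ≤ 4 * G.edgeFinset.card := by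
  induction t with
  | zero => exact (searching_init L s i).moves_le hG
  | succ t ih =>
    by_cases hs : ((run L s sched choice (t + 1)).mem i).state = .settled
    · obtain ⟨v, hd⟩ := (sound_run ..).exists_dockedAt hs
      have hdep : ¬ Departs (run L s sched choice t) (run L s sched choice (t + 1)) i :=
        fun h => by cases hd.1.symm.trans h.2
      rwa [moves_succ, if_neg fun h => hdep h.2]
    · exact (searching_run hG hk i (t + 1) hs).moves_le hG

theorem departs_run (hG : G.Connected) (hk : k ≤ Fintype.card V) {t : ℕ} {lost : Bool}
    (hact : ((run L s sched choice t).mem (sched t)).phase = .act lost) :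
    Departs (run L s sched choice t) (run L s sched choice (t + 1)) (sched t) :=
  have hs : ((run L s sched choice t).mem (sched t)).state ≠ .settled := fun hs => by
    cases hact.symm.trans (((sound_run ..).settled_iff _).1 hs)
  ((searching_run hG hk _ t hs).transition_act hG hk (sound_run ..) hs (transition_run ..) hact).2

theorem activeSteps_le (hG : G.Connected) (hk : k ≤ Fintype.card V) (i : Fin k) (t : ℕ) :
    activeSteps L s sched choice i t ≤
      4 * moves L s sched choice i t + stage (run L s sched choice t) i := by
  induction t with
  | zero => simp [activeSteps]
  | succ t ih =>
    have hst := transition_run L s sched choice t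
    have hc := sound_run L s sched choice t
    have hstage := stage_le (c := run L s sched choice t) (i := i)
    rw [activeSteps_succ, moves_succ]
    by_cases hs : ((run L s sched choice t).mem i).state = .settled
    · rw [if_neg fun h => h.2.1 hs, (hst.sound hc).stage_eq (hst.settled hc hs)]
      omega
    by_cases hi : sched t = i
    · subst hi
      by_cases hact : ∃ lost, ((run L s sched choice t).mem (sched t)).phase = .act lost
      · obtain ⟨lost, hact⟩ := hact
        rw [if_pos (And.intro rfl (departs_run hG hk hact))]
        split_ifs <;> omega
      by_cases hw : (run L s sched choice t).Waits (sched t)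
      · rw [hst.eq_self_of_waits hc hs hw, if_neg fun h => h.2.2 hw]
        omega
      · have hlt := hst.stage_lt hc hs hw (not_exists.1 hact)
        split_ifs <;> omega
    · have hle := hst.stage_le_of_ne (Ne.symm hi)
      rw [if_neg fun h => hi h.1, if_neg fun h => hi h.1]
      omega

theorem activeSteps_le_mul (hG : G.Connected) (hk : k ≤ Fintype.card V) (i : Fin k) (t : ℕ) :
    activeSteps L s sched choice i t ≤ 19 * max 1 G.edgeFinset.card := by
  have hactive := activeSteps_le (L := L) (s := s) (sched := sched) (choice := choice) hG hk i t
  have hmoves := moves_le (L := L) (s := s) (sched := sched) (choice := choice) hG hk i t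
  have hstage := stage_le (c := run L s sched choice t) (i := i)
  omega

theorem eventually_activeSteps_eq (hG : G.Connected) (hk : k ≤ Fintype.card V) (i : Fin k) :
    ∃ a T, ∀ t ≥ T, activeSteps L s sched choice i t = a := by
  have hmono : Monotone (activeSteps L s sched choice i) := fun _ _ h =>
    Finset.card_le_card (Finset.filter_subset_filter _ (Finset.range_mono h))
  have hbdd : BddAbove (Set.range (activeSteps L s sched choice i)) :=
    ⟨_, Set.forall_mem_range.2 (activeSteps_le_mul hG hk i)⟩
  have hlim := tendsto_atTop_ciSup hmono hbdd
  rw [nhds_discrete, Filter.tendsto_pure, Filter.eventually_atTop] at hlim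
  exact ⟨_, hlim⟩

theorem exists_forall_waits (hG : G.Connected) (hk : k ≤ Fintype.card V)
    (hact : ActiveForever sched i)
    (hs : ∀ t, ((run L s sched choice t).mem i).state ≠ .settled) :
    ∃ T, ∀ t ≥ T, (run L s sched choice t).Waits i := by
  obtain ⟨a, T, hT⟩ := eventually_activeSteps_eq (L := L) (s := s) (sched := sched)
    (choice := choice) hG hk i
  have hsched : ∀ t ≥ T, sched t = i → (run L s sched choice t).Waits i := by
    intro t ht hi
    by_contra hw
    have hsucc := activeSteps_succ (L := L) (s := s) (choice := choice) (sched := sched) i t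
    rw [if_pos ⟨hi, hs t, hw⟩, hT t ht, hT (t + 1) (Nat.le_succ_of_le ht)] at hsucc
    omega
  refine ⟨T, fun t ht => ?_⟩
  by_contra hw
  have hnever : ∀ t' ≥ t, ¬ (run L s sched choice t').Waits i := by
    intro t' ht'
    induction t', ht' using Nat.le_induction with
    | base => exact hw
    | succ t' ht' ih =>
      have hi : i ≠ sched t' := fun hi => ih (hsched t' (ht.trans ht') hi.symm)
      rwa [Config.Waits, (transition_run ..).mem_of_ne hi fun _ _ h => ih h.2.2]
  obtain ⟨t', ht', hi⟩ := hact t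
  exact hnever t' ht' (hsched t' (ht.trans ht') hi)

theorem exists_settled (hG : G.Connected) (hk : k ≤ Fintype.card V)
    (hact : ∀ i, ActiveForever sched i) (i : Fin k) :
    ∃ t, ((run L s sched choice t).mem i).state = .settled := by
  by_contra! hs
  obtain ⟨T, hT⟩ := exists_forall_waits (L := L) (s := s) (choice := choice) hG hk (hact i) hs
  obtain ⟨u, hu, r, hl⟩ :=
    (searching_run hG hk i T (hs T)).exists_waitsAt (sound_run ..) (hs T) (hT T le_rfl)
  have hwaits : ∀ t ≥ T, (run L s sched choice t).WaitsAt i u := by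
    intro t ht
    induction t, ht using Nat.le_induction with
    | base => exact hu
    | succ t ht ih =>
      refine ⟨?_, hs _, hT _ (Nat.le_succ_of_le ht)⟩
      rw [(transition_run ..).place_of_waitsAt (sound_run ..) ih]
      exact ih.1
  obtain ⟨t₁, ht₁, rfl⟩ := hact r T
  have hd := (transition_run L s sched choice t₁).dockedAt_of_lock (sound_run ..) (lock_run ht₁ hl)
  obtain ⟨t₂, ht₂, hr⟩ := hact (sched t₁) (t₁ + 1)
  have hd₂ := dockedAt_run ht₂ hd
  rw [← hr] at hd₂
  exact (transition_run L s sched choice t₂).not_waits_of_dockedAt hd₂ (hwaits t₂ (by omega))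
    (hT (t₂ + 1) (by omega))

theorem dispersion (hG : G.Connected) (hk : k ≤ Fintype.card V)
    (hact : ∀ i, ActiveForever sched i) :
    ∃ f : Fin k → V, Function.Injective f ∧
      ∃ T : ℕ, ∀ t ≥ T, ∀ i, (run L s sched choice t).DockedAt i (f i) := by
  choose τ hτ using exists_settled (L := L) (s := s) (choice := choice) hG hk hact
  choose f hf using fun i => (sound_run L s sched choice (τ i)).exists_dockedAt (hτ i)
  have hdocked : ∀ t ≥ Finset.univ.sup τ, ∀ i, (run L s sched choice t).DockedAt i (f i) :=
    fun t ht i => dockedAt_run ((Finset.le_sup (Finset.mem_univ i)).trans ht) (hf i)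
  refine ⟨f, fun i j hij => ?_, _, hdocked⟩
  have hi := hdocked _ le_rfl i
  rw [hij] at hi
  exact (sound_run ..).dockedAt_unique hi (hdocked _ le_rfl j)

end Dispersion

/-! ### Memory -/

section MemorySize

variable {V : Type u} {k Δ : ℕ}

/-- All ports in a memory are less than `Δ`. -/
structure Memory.Bounded (Δ : ℕ) (m : Memory k) : Prop where
  portEntered : m.portEntered ∈ Set.Ico (-1) (Δ : ℤ)
  parentPtr : m.parentPtr ∈ Set.Ico (-1) (Δ : ℤ)
  entryPort : ∀ x, m.entryPort x ∈ Set.Ico (-1) (Δ : ℤ)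

/-- The port, if any, through which a robot has entered, or is going to enter, its node is less
than `Δ`. -/
def Place.Bounded (Δ : ℕ) : Place V → Prop
  | .at _ entry => ∀ e ∈ entry, e < Δ
  | .transit _ e => e < Δ

/-- All ports in a configuration are less than `Δ`. -/
structure Config.Bounded (Δ : ℕ) (c : Config V k) : Prop where
  place : ∀ i, (c.place i).Bounded Δ
  mem : ∀ i, (c.mem i).Bounded Δ

theorem neg_one_mem_Ico (Δ : ℕ) : (-1 : ℤ) ∈ Set.Ico (-1) (Δ : ℤ) :=
  ⟨le_rfl, by omega⟩

theorem bounded_init (s : Fin k → V) : (Config.init s).Bounded Δ where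
  place _ := nofun
  mem _ := ⟨neg_one_mem_Ico Δ, neg_one_mem_Ico Δ, fun _ => neg_one_mem_Ico Δ⟩

variable [DecidableEq V] {c c' : Config V k} {i j : Fin k} {v : V}

theorem Memory.Bounded.stepHelp (h : ∀ l, (c.mem l).Bounded Δ) (i j : Fin k) (v : V) :
    ((stepHelp j v c).mem i).Bounded Δ := by
  simp only [HelpingAsync.stepHelp]
  split_ifs
  · refine ⟨(h j).portEntered, (h j).parentPtr, fun x => ?_⟩
    dsimp only
    split_ifs
    · exact (h x).portEntered
    · exact (h j).entryPort x
  · exact ⟨(h i).portEntered, (h i).portEntered, (h i).entryPort⟩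
  · exact ⟨(h i).portEntered, (h j).entryPort i, (h i).entryPort⟩
  · exact ⟨(h i).portEntered, (h i).portEntered, (h i).entryPort⟩
  · exact ⟨(h i).portEntered, (h j).entryPort i, (h i).entryPort⟩
  · exact h i

theorem Memory.Bounded.stepStart {entry : Option ℕ} (h : ∀ l, (c.mem l).Bounded Δ)
    (he : ∀ e ∈ entry, e < Δ) (i j : Fin k) (v : V) :
    ((stepStart j v entry c).mem i).Bounded Δ := by
  revert i
  refine (Function.forall_update_iff _ fun _ (m : Memory k) => m.Bounded Δ).2 ⟨?_, fun i _ => h i⟩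
  cases entry with
  | none => exact ⟨(h j).portEntered, (h j).parentPtr, (h j).entryPort⟩
  | some e =>
    have he : (e : ℤ) ∈ Set.Ico (-1) (Δ : ℤ) := ⟨by omega, by simpa using he⟩
    exact ⟨he, he, (h j).entryPort⟩

variable [Fintype V] {G : SimpleGraph V} [DecidableRel G.Adj] {L : PortLabeling G}

theorem bounded_depart {entry : Option ℕ} {p : ℤ} (hΔ : G.maxDegree ≤ Δ)
    (h : (depart L v entry p).node? = none) :
    (depart L v entry p).Bounded Δ ∧ p ∈ Set.Ico (-1) (Δ : ℤ) := by
  have hdeg := (G.degree_le_maxDegree v).trans hΔ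
  unfold depart at h ⊢
  split_ifs at h ⊢ with hp
  · exact ⟨(Fin.is_lt _).trans_le ((G.degree_le_maxDegree _).trans hΔ), by omega, by omega⟩
  · cases h

theorem Config.Bounded.stepAct {entry : Option ℕ} {lost : Bool} (h : c.Bounded Δ)
    (hΔ : G.maxDegree ≤ Δ) (hdep : Departs c (stepAct L j v entry lost c) j) :
    (stepAct L j v entry lost c).Bounded Δ := by
  have hnode := hdep.2
  simp only [HelpingAsync.stepAct, Function.update_self] at hnode
  obtain ⟨hplace, hport⟩ := bounded_depart hΔ hnode
  constructor
  · exact (Function.forall_update_iff _ fun _ (P : Place V) => P.Bounded Δ).2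
      ⟨hplace, fun i _ => h.place i⟩
  · refine (Function.forall_update_iff _ fun _ (m : Memory k) => m.Bounded Δ).2 ⟨⟨hport, ?_, ?_⟩,
      fun i _ => h.mem i⟩
    · split_ifs <;> exact (h.mem j).parentPtr
    · split_ifs <;> exact (h.mem j).entryPort

theorem Config.Bounded.transition (h : c.Bounded Δ) (hΔ : G.maxDegree ≤ Δ)
    (hst : Transition L j c c') (hdep : ∀ lost, (c.mem j).phase = .act lost → Departs c c' j) :
    c'.Bounded Δ := by
  have hj := h.mem j
  have hupdate (m : Memory k) (hm : m.Bounded Δ) (i : Fin k) :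
      (Function.update c.mem j m i).Bounded Δ :=
    (Function.forall_update_iff _ fun _ (m : Memory k) => m.Bounded Δ).2 ⟨hm, fun i _ => h.mem i⟩ i
  cases hst with
  | idle => exact h
  | arrive v p hp =>
    have hplace := h.place j
    rw [hp] at hplace
    refine ⟨(Function.forall_update_iff _ fun _ (P : Place V) => P.Bounded Δ).2
      ⟨?_, fun i _ => h.place i⟩, h.mem⟩
    simpa [Place.Bounded] using hplace
  | help v => exact ⟨h.place, fun i => Memory.Bounded.stepHelp h.mem i j v⟩
  | start v e hp =>
    have hplace := h.place j
    rw [hp] at hplace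
    exact ⟨h.place, fun i => Memory.Bounded.stepStart h.mem hplace i j v⟩
  | dock =>
    exact ⟨h.place, hupdate _ ⟨hj.portEntered, hj.parentPtr, fun _ => neg_one_mem_Ico Δ⟩⟩
  | lose => exact ⟨h.place, hupdate _ ⟨hj.portEntered, hj.parentPtr, hj.entryPort⟩⟩
  | act _ _ lost _ _ hph => exact h.stepAct hΔ (hdep lost hph)

theorem bounded_run {s : Fin k → V} {sched choice : ℕ → Fin k} (hG : G.Connected)
    (hk : k ≤ Fintype.card V) (hΔ : G.maxDegree ≤ Δ) (t : ℕ) :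
    (run L s sched choice t).Bounded Δ := by
  induction t with
  | zero => exact bounded_init s
  | succ t ih => exact ih.transition hΔ (transition_run ..) fun _ => departs_run hG hk

end MemorySize

section Codes

variable {k Δ : ℕ}

instance : Fintype Phase where
  elems := {.start, .contend, .await false, .await true, .act false, .act true, .help}
  complete := by rintro (_ | _ | (_ | _) | (_ | _) | _) <;> decide

instance : Fintype RobotState where
  elems := {.explore, .backtrack, .settled}
  complete := by rintro (_ | _ | _) <;> decide

/-- The labels and memories of the robots, for ports less than `Δ`, as a finite type.  Ports are
shifted by one, since they start from `-1`. -/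
abbrev Code (k Δ : ℕ) : Type :=
  Fin k × Phase × RobotState × Bool × Fin (Δ + 1) × Fin (Δ + 1) × (Fin k → Bool) ×
    (Fin k → Fin (Δ + 1))

/-- The label and memory that belong to a code. -/
def Code.decode : Code k Δ → Fin k × Memory k
  | (i, phase, state, seen, portEntered, parentPtr, visited, entryPort) => (i, {
    phase, state, seen, visited
    portEntered := (portEntered : ℕ) - 1
    parentPtr := (parentPtr : ℕ) - 1
    entryPort := fun x => (entryPort x : ℕ) - 1 })

theorem exists_code (i : Fin k) {m : Memory k} (hm : m.Bounded Δ) :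
    ∃ x : Code k Δ, x.decode = (i, m) := by
  have hport (p : ℤ) (hp : p ∈ Set.Ico (-1) (Δ : ℤ)) :
      ∃ x : Fin (Δ + 1), ((x : ℕ) : ℤ) - 1 = p :=
    have ⟨_, _⟩ := hp
    ⟨⟨(p + 1).toNat, by omega⟩, by dsimp only; omega⟩
  obtain ⟨portEntered, hportEntered⟩ := hport _ hm.portEntered
  obtain ⟨parentPtr, hparentPtr⟩ := hport _ hm.parentPtr
  choose entryPort hentryPort using fun x => hport _ (hm.entryPort x)
  refine ⟨(i, m.phase, m.state, m.seen, portEntered, parentPtr, m.visited, entryPort), ?_⟩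
  simp only [Code.decode, hportEntered, hparentPtr, hentryPort]

theorem card_code_le (k Δ : ℕ) :
    Fintype.card (Code k Δ) ≤ 2 ^ (2 * k + 6 + (k + 2) * (Nat.log 2 Δ + 1)) := by
  have hk : k ≤ 2 ^ k := Nat.lt_two_pow_self.le
  have hΔ : Δ + 1 ≤ 2 ^ (Nat.log 2 Δ + 1) := Nat.lt_pow_succ_log_self Nat.one_lt_two Δ
  have hphase : Fintype.card Phase = 7 := rfl
  have hstate : Fintype.card RobotState = 3 := rfl
  calc Fintype.card (Code k Δ) = k * (42 * (2 ^ k * (Δ + 1) ^ (k + 2))) := by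
        simp only [Fintype.card_prod, Fintype.card_fin, Fintype.card_bool, Fintype.card_fun,
          hphase, hstate]
        ring
    _ ≤ 2 ^ k * (2 ^ 6 * (2 ^ k * (2 ^ (Nat.log 2 Δ + 1)) ^ (k + 2))) := by
        gcongr
        norm_num
    _ = 2 ^ (2 * k + 6 + (k + 2) * (Nat.log 2 Δ + 1)) := by
        rw [← pow_mul]
        ring

theorem codeLength_le (hk : 1 ≤ k) : ((2 * k + 6 + (k + 2) * (Nat.log 2 Δ + 1) : ℕ) : ℝ) ≤
    (14 : ℕ) * (k * max 1 (Real.logb 2 Δ)) := by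
  have hk' : (1 : ℝ) ≤ k := by exact_mod_cast hk
  have hone : 1 ≤ max 1 (Real.logb 2 Δ) := le_max_left _ _
  have hlog : (Nat.log 2 Δ : ℝ) ≤ max 1 (Real.logb 2 Δ) :=
    (by exact_mod_cast Real.natLog_le_logb Δ 2 : (Nat.log 2 Δ : ℝ) ≤ _).trans (le_max_right _ _)
  push_cast
  generalize max 1 (Real.logb 2 Δ) = x at *
  calc (2 * k + 6 + (k + 2) * (Nat.log 2 Δ + 1) : ℝ)
      ≤ 2 * k + 6 * k + (k + 2 * k) * (x + x) := by gcongr <;> linarith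
    _ = 8 * (k * 1) + 6 * (k * x) := by ring
    _ ≤ 8 * (k * x) + 6 * (k * x) := by gcongr
    _ = 14 * (k * x) := by ring

theorem exists_decode (k Δ : ℕ) (hk : 1 ≤ k) :
    ∃ (B : ℕ) (decode : (Fin B → Bool) → Fin k × Memory k),
      (B : ℝ) ≤ (14 : ℕ) * (k * max 1 (Real.logb 2 Δ)) ∧
      ∀ (i : Fin k) (m : Memory k), m.Bounded Δ → ∃ bits, decode bits = (i, m) := by
  have : Nonempty (Code k Δ) := ⟨⟨0, hk⟩, .start, .explore, false, 0, 0, fun _ => false, 0⟩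
  obtain ⟨f⟩ := Function.Embedding.nonempty_of_card_le (α := Code k Δ)
    (β := Fin (2 * k + 6 + (k + 2) * (Nat.log 2 Δ + 1)) → Bool)
    (by simpa only [Fintype.card_fun, Fintype.card_bool, Fintype.card_fin] using card_code_le k Δ)
  refine ⟨_, fun bits => (Function.invFun f bits).decode, codeLength_le hk, fun i m hm => ?_⟩
  obtain ⟨x, hx⟩ := exists_code i hm
  exact ⟨f x, (congrArg Code.decode (Function.leftInverse_invFun f.injective x)).trans hx⟩

end Codes

/-! ### Stopping a docked robot -/

section Stopping

/-- The labelling of the ports by an arbitrary numbering of the neighbours of each node. -/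
noncomputable def someLabeling {V : Type u} [Fintype V] [DecidableEq V] (G : SimpleGraph V)
    [DecidableRel G.Adj] : PortLabeling G where
  port v := Fintype.equivFinOfCardEq (G.card_neighborSet_eq_degree v)

/-- Robot `0` is docked at node `0`, and robot `1` is at the same node, with memory `m`. -/
def dockedPair (m : Memory 2) : Config (Fin 2) 2 where
  place _ := .at 0 none
  mem := ![{ Memory.init 2 with phase := .help, state := .settled }, m]
  lock := Function.update (fun _ => none) 0 (some 0)

/-- The schedule in which robot `0` takes the first `c + 2` steps and robot `1` takes all others. -/
def stoppingSched (c t : ℕ) : Fin 2 :=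
  if t < c + 2 then 0 else 1

variable {L : PortLabeling (⊤ : SimpleGraph (Fin 2))}

theorem step_step_init :
    step L 0 0 (step L 0 0 (Config.init fun _ => 0)) = dockedPair (Memory.init 2) := by
  have hdocked : ¬ ∃ j, (Config.init (k := 2) fun _ => (0 : Fin 2)).DockedAt j 0 := by
    simp [Config.init, Memory.init]
  have hcontend : step L 0 0 (Config.init fun _ => 0) =
      { Config.init (k := 2) fun _ => (0 : Fin 2) with
        mem := ![{ Memory.init 2 with phase := .contend }, Memory.init 2] } := by
    change stepStart 0 0 none _ = _
    simp only [stepStart, hdocked, or_false]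
    simp only [Config.init, Config.mk.injEq, true_and, and_true]
    funext i
    fin_cases i <;> rfl
  rw [hcontend]
  change stepContend 0 0 0 _ = _
  simp only [stepContend, Config.init, dockedPair, Config.mk.injEq, true_and]
  refine ⟨?_, rfl⟩
  funext i
  fin_cases i <;> rfl

theorem step_zero_dockedPair :
    step L 0 0 (dockedPair (Memory.init 2)) = dockedPair (Memory.init 2) := by
  have hwaits : ∀ x, ¬ (dockedPair (Memory.init 2)).WaitsAt x 0 := by
    intro x
    fin_cases x <;> simp [dockedPair, Memory.init, Config.WaitsAt, Config.Waits]
  change stepHelp 0 0 _ = _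
  simp only [stepHelp, hwaits, if_false, decide_false, Bool.or_false, false_and]
  simp only [dockedPair, Config.mk.injEq, true_and, and_true]
  funext i
  fin_cases i <;> rfl

theorem step_one_dockedPair : step L 1 0 (dockedPair (Memory.init 2)) =
    dockedPair { Memory.init 2 with phase := .await false } := by
  have hdocked : ∃ j, (dockedPair (Memory.init 2)).DockedAt j 0 := ⟨0, rfl, rfl⟩
  change stepStart 1 0 none _ = _
  simp only [stepStart, hdocked, or_true, if_true]
  simp only [dockedPair, Config.mk.injEq, true_and, and_true]
  funext i
  fin_cases i <;> rfl

theorem step_one_waiting : step L 1 0 (dockedPair { Memory.init 2 with phase := .await false }) =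
    dockedPair { Memory.init 2 with phase := .await false } := rfl

theorem run_stoppingSched_of_le {c t : ℕ} (h2 : 2 ≤ t) (htc : t ≤ c + 2) :
    run L (fun _ => 0) (stoppingSched c) (fun _ => 0) t = dockedPair (Memory.init 2) := by
  induction t, h2 using Nat.le_induction with
  | base => simpa [run, stoppingSched] using step_step_init
  | succ t _ ih =>
    rw [run, ih (by omega), stoppingSched, if_pos (by omega), step_zero_dockedPair]

theorem run_stoppingSched_of_lt {c t : ℕ} (htc : c + 2 < t) :
    run L (fun _ => 0) (stoppingSched c) (fun _ => 0) t =
      dockedPair { Memory.init 2 with phase := .await false } := by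
  induction t, htc using Nat.le_induction with
  | base =>
    rw [run, run_stoppingSched_of_le (by omega) le_rfl, stoppingSched, if_neg (by omega),
      step_one_dockedPair]
  | succ t ht ih => rw [run, ih, stoppingSched, if_neg (by omega), step_one_waiting]

theorem exists_forall_waitsAt (c : ℕ) : ∃ (n k : ℕ) (G : SimpleGraph (Fin n))
    (_ : DecidableRel G.Adj) (L : PortLabeling G) (s : Fin k → Fin n) (sched choice : ℕ → Fin k)
    (i j : Fin k) (v : Fin n) (t₀ t₁ t₂ : ℕ),
    G.Connected ∧ k ≤ n ∧ i ≠ j ∧ (run L s sched choice t₀).DockedAt j v ∧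
      c ≤ ((Finset.Ico t₀ t₁).filter fun t => sched t = j).card ∧
      (∀ t ≥ t₁, sched t ≠ j) ∧ (∀ i' ≠ j, ActiveForever sched i') ∧
      (∀ t ≥ t₂, (run L s sched choice t).WaitsAt i v) := by
  refine ⟨2, 2, ⊤, inferInstance, someLabeling ⊤, fun _ => 0, stoppingSched c, fun _ => 0,
    1, 0, 0, 2, c + 2, c + 3, SimpleGraph.connected_top, le_rfl, by decide, ?_, ?_, ?_, ?_, ?_⟩
  · rw [run_stoppingSched_of_le le_rfl (by omega)]
    exact ⟨rfl, rfl⟩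
  · have hsched : ∀ t ∈ Finset.Ico 2 (c + 2), stoppingSched c t = 0 := fun t ht =>
      if_pos (Finset.mem_Ico.1 ht).2
    rw [Finset.filter_true_of_mem hsched, Nat.card_Ico, Nat.add_sub_cancel]
  · intro t ht
    simp [stoppingSched, ht.not_gt]
  · intro i hi t
    exact ⟨t + c + 2, by omega, by rw [stoppingSched, if_neg (by omega)]; omega⟩
  · intro t ht
    rw [run_stoppingSched_of_lt ht]
    exact ⟨rfl, nofun, .inl rfl⟩

end Stopping

end HelpingAsync

theorem theorem3 :
    -- dispersion is achieved, and every robot docks within `O(m)` steps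
    (∃ C : ℕ, ∀ (V : Type u) [Fintype V] [DecidableEq V] (G : SimpleGraph V) [DecidableRel G.Adj]
      (L : HelpingAsync.PortLabeling G) (k : ℕ) (s : Fin k → V) (sched choice : ℕ → Fin k),
      G.Connected → k ≤ Fintype.card V →
        -- steps and moves of an undocked robot
        (∀ (i : Fin k) (t : ℕ),
          HelpingAsync.activeSteps L s sched choice i t ≤ C * max 1 G.edgeFinset.card ∧
          HelpingAsync.moves L s sched choice i t + 2 * (Fintype.card V - 1)
            ≤ 4 * G.edgeFinset.card) ∧
        -- a docked robot stays docked
        (∀ (i : Fin k) (v : V) (t t' : ℕ), t ≤ t' →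
          (HelpingAsync.run L s sched choice t).DockedAt i v →
          (HelpingAsync.run L s sched choice t').DockedAt i v) ∧
        -- if all robots, the docked ones included, stay active then they dock at distinct nodes
        ((∀ i, HelpingAsync.ActiveForever sched i) →
          ∃ f : Fin k → V, Function.Injective f ∧
            ∃ T : ℕ, ∀ t ≥ T, ∀ i, (HelpingAsync.run L s sched choice t).DockedAt i (f i))) ∧
    -- the label and the memory of each robot fit into `O(k log Δ)` bits
    (∃ C : ℕ, ∀ k Δ : ℕ, 1 ≤ k → ∃ (B : ℕ) (decode : (Fin B → Bool) → Fin k × HelpingAsync.Memory k),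
      (B : ℝ) ≤ C * (k * max 1 (Real.logb 2 Δ)) ∧
      ∀ (V : Type u) [Fintype V] [DecidableEq V] (G : SimpleGraph V) [DecidableRel G.Adj]
        (L : HelpingAsync.PortLabeling G) (s : Fin k → V) (sched choice : ℕ → Fin k),
        G.Connected → k ≤ Fintype.card V → G.maxDegree ≤ Δ →
          ∀ (i : Fin k) (t : ℕ), ∃ bits : Fin B → Bool,
            decode bits = (i, (HelpingAsync.run L s sched choice t).mem i)) ∧
    -- no bound on the number of its steps after which a docked robot may stop
    (∀ c : ℕ, ∃ (n k : ℕ) (G : SimpleGraph (Fin n)) (_ : DecidableRel G.Adj)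
      (L : HelpingAsync.PortLabeling G) (s : Fin k → Fin n) (sched choice : ℕ → Fin k)
      (i j : Fin k) (v : Fin n) (t₀ t₁ t₂ : ℕ),
      G.Connected ∧ k ≤ n ∧ i ≠ j ∧
      -- robot `j` docks and then takes at least `c` further steps, but not infinitely many
      (HelpingAsync.run L s sched choice t₀).DockedAt j v ∧
      c ≤ ((Finset.Ico t₀ t₁).filter fun t => sched t = j).card ∧
      (∀ t ≥ t₁, sched t ≠ j) ∧
      (∀ i' ≠ j, HelpingAsync.ActiveForever sched i') ∧
      -- and then robot `i` stays undocked forever, at the node of robot `j`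
      (∀ t ≥ t₂, (HelpingAsync.run L s sched choice t).WaitsAt i v)) := by
  refine ⟨⟨19, ?_⟩, ⟨14, fun k Δ hk => ?_⟩, HelpingAsync.exists_forall_waitsAt⟩
  · intro V _ _ G _ L k s sched choice hG hk
    exact ⟨fun i t => ⟨HelpingAsync.activeSteps_le_mul hG hk i t, HelpingAsync.moves_le hG hk i t⟩,
      fun i v t t' => HelpingAsync.dockedAt_run, HelpingAsync.dispersion hG hk⟩
  · obtain ⟨B, decode, hB, h⟩ := HelpingAsync.exists_decode k Δ hk
    refine ⟨B, decode, hB, ?_⟩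
    intro V _ _ G _ L s sched choice hG hk hΔ i t
    exact h i _ ((HelpingAsync.bounded_run hG hk hΔ t).mem i)
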